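/- Let $I\subseteq\mathbb{R}$ be an open interval and $\gamma=(\gamma_1,\gamma_2):I\to\mathbb{R}^2$ a smooth curve in the $xy$-plane whose tangents are nowhere parallel to the $x$- or $y$-axis, let $n$ be a smooth vector field along $\gamma$ that is nowhere tangent to $\gamma$ (for instance a unit normal field), and let $\phi_1,\phi_2,\psi_1,\psi_2$ be smooth functions on $I$. Consider the Cauchy problem $$u_{xy}+\frac{u_xu_y}{2(1+e^{u/2+v/2})}=0,\qquad v_{xy}+\frac{v_xv_y}{2(1+e^{u/2+v/2})}=0,$$ $$u|_\gamma=\phi_1,\quad v|_\gamma=\phi_2,\quad \frac{\partial u}{\partial n}\Big|_\gamma=\psi_1,\quad \frac{\partial v}{\partial n}\Big|_\gamma=\psi_2 ,$$ which, with $u_1=(u+v)/2$ and $u_2=(u-v)/2$, is the Cauchy problem for wave maps $(u_1,u_2)$ from $(\mathbb{R}^{1,1},dx\,dy)$ into the plane with the metric $(du_1^2-du_2^2)/(1+e^{-u_1})$. The Cauchy data determine the values of $u_x,u_y,v_x,v_y$ along $\gamma$; the first equation then determines $u_{xy}$, and differentiation of $u_y$ along $\gamma$ determines $u_{yy}$.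 Assume that the values of $u_x$ and $u_y$ vanish nowhere on $\gamma$. Since $\gamma_2$ is injective, functions $k_1,k_2$ on $\gamma_2(I)$ are defined by requiring, along $\gamma$, $$k_1(y)=\frac{u_yv_y}{1+e^{-(u+v)/2}},\qquad k_2(y)=\frac{2u_{yy}+u_y^2-k_1(y)}{u_y}.$$ Let $\zeta$ be the value of $u_y$ along $\gamma$. Call an open set $\Omega$ with $\gamma(I)\subseteq\Omega\subseteq\gamma_1(I)\times\gamma_2(I)$ admissible if all its horizontal and vertical slices are intervals. Consider on $\Omega$ the Riccati initial value problem $$\frac{\partial\Gamma}{\partial y}=\tfrac12\bigl(k_1(y)+k_2(y)\Gamma-\Gamma^2\bigr),\qquad \Gamma|_\gamma=\zeta, \tag{R}$$ the quadrature $$\frac{\partial u}{\partial y}=\Gamma,\qquad u|_\gamma=\phi_1, \tag{Q}$$ and the equation $$u_{xy}+\frac{u_xu_y}{2(1+e^{u/2+v/2})}=0 \tag{A}$$ as an equation for $v$. Then: 1. There are an admissible $\Omega$ and functions $\Gamma,u,v$ on $\Omega$ that satisfy (R), (Q) and (A). 2. Whenever $\Gamma,u,v$ satisfy (R), (Q)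 and (A) on an admissible $\Omega$, then $\Gamma$ is smooth and is the only solution of (R) on $\Omega$, $u$ is the only solution of (Q), and $v$ is determined algebraically: $u_{xy}$ vanishes nowhere on $\Omega$ and $e^{v/2}=-e^{-u/2}\bigl(1+\frac{u_xu_y}{2u_{xy}}\bigr)$. Moreover $(u,v)$ is a smooth solution of the Cauchy problem on $\Omega$ and the only smooth one, and $\bigl(\frac{u+v}2,\frac{u-v}2\bigr)$ is the unique smooth wave map on $\Omega$ with the corresponding Cauchy data. 3. Conversely, if $(u,v)$ is a smooth solution of the Cauchy problem on an admissible $\Omega$, then $\Gamma=u_y$, $u$, $v$ satisfy (R), (Q) and (A) on $\Omega$. So the Cauchy problem reduces to one Riccati initial value problem together with one quadrature. -/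

import Mathlib

open scoped ContDiff

noncomputable section

namespace WaveMap

/-- Partial derivative `∂f/∂x` of a function of `(x, y)`. -/
def dx (f : ℝ × ℝ → ℝ) (p : ℝ × ℝ) : ℝ := deriv (fun s => f (s, p.2)) p.1

/-- Partial derivative `∂f/∂y` of a function of `(x, y)`. -/
def dy (f : ℝ × ℝ → ℝ) (p : ℝ × ℝ) : ℝ := deriv (fun s => f (p.1, s)) p.2

/-! ### Wave maps from the Minkowski plane `(ℝ², dx dy)` to a pseudo-Riemannian plane -/

/-- The coordinate derivatives `∂₀ = ∂/∂x`, `∂₁ = ∂/∂y` on the Minkowski plane. -/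
def pd (i : Fin 2) (f : ℝ × ℝ → ℝ) : ℝ × ℝ → ℝ := if i = 0 then dx f else dy f

/-- The flat Lorentzian metric `dx dy` in the coordinates `(x, y)`. -/
def minkowski : Matrix (Fin 2) (Fin 2) ℝ := !![0, 1 / 2; 1 / 2, 0]

/-- The target metric `(du₁² - du₂²) / (1 + exp (-u₁))` in the coordinates `(u₁, u₂)`. -/
def targetMetric (z : Fin 2 → ℝ) : Matrix (Fin 2) (Fin 2) ℝ :=
  !![1 / (1 + Real.exp (-z 0)), 0; 0, -(1 / (1 + Real.exp (-z 0)))]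

/-- Coordinate derivative on the target plane. -/
def tpd (a : Fin 2) (F : (Fin 2 → ℝ) → ℝ) (z : Fin 2 → ℝ) : ℝ :=
  fderiv ℝ F z (Pi.single a 1)

/-- Christoffel symbols `Λ^c_{ab}` of a metric `h` on the plane. -/
def christoffel (h : (Fin 2 → ℝ) → Matrix (Fin 2) (Fin 2) ℝ) (z : Fin 2 → ℝ)
    (c a b : Fin 2) : ℝ :=
  (1 / 2) * ∑ d, (h z)⁻¹ c d *
    (tpd a (fun w => h w d b) z + tpd b (fun w => h w d a) z - tpd d (fun w => h w a b) z)

/-- `U` is smooth on `Ω` and satisfies there the wave map (harmonic map) equation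
`g^{ij} (∂ᵢ∂ⱼ U^c + Λ^c_{ab}(U) ∂ᵢU^a ∂ⱼU^b) = 0`, where `g = dx dy` is flat. -/
structure IsWaveMapOn (h : (Fin 2 → ℝ) → Matrix (Fin 2) (Fin 2) ℝ) (Ω : Set (ℝ × ℝ))
    (U : ℝ × ℝ → Fin 2 → ℝ) : Prop where
  smooth : ContDiffOn ℝ ∞ U Ω
  equation : ∀ p ∈ Ω, ∀ c : Fin 2,
    ∑ i, ∑ j, minkowski⁻¹ i j *
      (pd i (pd j (fun q => U q c)) p
        + ∑ a, ∑ b, christoffel h (U p) c a b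
            * pd i (fun q => U q a) p * pd j (fun q => U q b) p) = 0

/-! ### Cauchy data -/

/-- Smooth Cauchy data along a smooth curve `γ`, parametrized by an open interval `I`, whose
tangents are nowhere parallel to a coordinate axis. The field `n` along `γ` is nowhere tangent
to `γ`; a unit normal field (for the Euclidean metric or for `dx dy`) is of this kind. -/
structure CauchyData where
  I : Set ℝ
  γ : ℝ → ℝ × ℝ
  n : ℝ → ℝ × ℝ
  φ₁ : ℝ → ℝ
  φ₂ : ℝ → ℝ
  ψ₁ : ℝ → ℝ
  ψ₂ : ℝ → ℝ
  isOpen_I : IsOpen I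
  ordConnected_I : I.OrdConnected
  smooth_γ : ContDiffOn ℝ ∞ γ I
  smooth_n : ContDiffOn ℝ ∞ n I
  smooth_φ₁ : ContDiffOn ℝ ∞ φ₁ I
  smooth_φ₂ : ContDiffOn ℝ ∞ φ₂ I
  smooth_ψ₁ : ContDiffOn ℝ ∞ ψ₁ I
  smooth_ψ₂ : ContDiffOn ℝ ∞ ψ₂ I
  tangent_fst : ∀ t ∈ I, (deriv γ t).1 ≠ 0
  tangent_snd : ∀ t ∈ I, (deriv γ t).2 ≠ 0
  transverse : ∀ t ∈ I, (deriv γ t).1 * (n t).2 - (deriv γ t).2 * (n t).1 ≠ 0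

namespace CauchyData

variable (D : CauchyData)

/-- The value along `γ` of the `x`-derivative of a function with values `φ` and
`n`-derivative `ψ` along `γ`: the first component of the solution `(a, b)` of
`a γ₁' + b γ₂' = φ'`, `a n₁ + b n₂ = ψ`. -/
def jetX (φ ψ : ℝ → ℝ) (t : ℝ) : ℝ :=
  (deriv φ t * (D.n t).2 - (deriv D.γ t).2 * ψ t)
    / ((deriv D.γ t).1 * (D.n t).2 - (deriv D.γ t).2 * (D.n t).1)

/-- The value along `γ` of the `y`-derivative: the second component of that solution. -/
def jetY (φ ψ : ℝ → ℝ) (t : ℝ) : ℝ :=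
  ((deriv D.γ t).1 * ψ t - deriv φ t * (D.n t).1)
    / ((deriv D.γ t).1 * (D.n t).2 - (deriv D.γ t).2 * (D.n t).1)

/-- Initial value of `u_x` along `γ`. -/
def ux (t : ℝ) : ℝ := D.jetX D.φ₁ D.ψ₁ t

/-- Initial value of `u_y` along `γ`. -/
def uy (t : ℝ) : ℝ := D.jetY D.φ₁ D.ψ₁ t

/-- Initial value of `v_y` along `γ`. -/
def vy (t : ℝ) : ℝ := D.jetY D.φ₂ D.ψ₂ t

/-- Initial value of `u_xy` along `γ`, dictated by the partial differential equation. -/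
def uxy (t : ℝ) : ℝ :=
  -(D.ux t * D.uy t / (2 * (1 + Real.exp (D.φ₁ t / 2 + D.φ₂ t / 2))))

/-- Initial value of `u_yy` along `γ`, from `d(u_y)/dt = u_xy γ₁' + u_yy γ₂'`. -/
def uyy (t : ℝ) : ℝ := (deriv D.uy t - D.uxy t * (deriv D.γ t).1) / (deriv D.γ t).2

end CauchyData

/-- The first integral `β₁ = u_y v_y / (1 + exp (-(u + v) / 2))`. -/
def beta₁ (u v uy vy : ℝ) : ℝ := uy * vy / (1 + Real.exp (-((u + v) / 2)))

/-- The first integral `β₃`, defined by `u_yy = ½ (β₁ + β₃ u_y - u_y²)`. -/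
def beta₃ (u v uy vy uyy : ℝ) : ℝ := (2 * uyy + uy ^ 2 - beta₁ u v uy vy) / uy

namespace CauchyData

variable (D : CauchyData)

/-- The parameter of the point of `γ` at height `y` (unique, as `γ₂' ≠ 0` on the interval `I`). -/
def paramAt (y : ℝ) : ℝ := Function.invFunOn (fun t => (D.γ t).2) D.I y

/-- `k₁(y)`: the value of `β₁` at the point of `γ` at height `y`. -/
def k₁ (y : ℝ) : ℝ :=
  beta₁ (D.φ₁ (D.paramAt y)) (D.φ₂ (D.paramAt y)) (D.uy (D.paramAt y)) (D.vy (D.paramAt y))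

/-- `k₂(y)`: the value of `β₃` at the point of `γ` at height `y`. -/
def k₂ (y : ℝ) : ℝ :=
  beta₃ (D.φ₁ (D.paramAt y)) (D.φ₂ (D.paramAt y)) (D.uy (D.paramAt y)) (D.vy (D.paramAt y))
    (D.uyy (D.paramAt y))

/-- Open neighbourhoods of the whole curve `γ` all of whose horizontal and vertical slices are
intervals meeting `γ`. -/
structure IsDomain (Ω : Set (ℝ × ℝ)) : Prop where
  isOpen : IsOpen Ω
  curve_mem : ∀ t ∈ D.I, D.γ t ∈ Ω
  fst_mem : ∀ p ∈ Ω, ∃ t ∈ D.I, (D.γ t).1 = p.1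
  snd_mem : ∀ p ∈ Ω, ∃ t ∈ D.I, (D.γ t).2 = p.2
  horizontal : ∀ y : ℝ, {x : ℝ | (x, y) ∈ Ω}.OrdConnected
  vertical : ∀ x : ℝ, {y : ℝ | (x, y) ∈ Ω}.OrdConnected

end CauchyData

/-! ### The Cauchy problem -/

/-- `u_xy + u_x u_y / (2 (1 + exp (u/2 + v/2))) = 0` on `Ω`. -/
def FirstPDE (Ω : Set (ℝ × ℝ)) (u v : ℝ × ℝ → ℝ) : Prop :=
  ∀ p ∈ Ω, dx (dy u) p + dx u p * dy u p / (2 * (1 + Real.exp (u p / 2 + v p / 2))) = 0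

/-- `v_xy + v_x v_y / (2 (1 + exp (u/2 + v/2))) = 0` on `Ω`. -/
def SecondPDE (Ω : Set (ℝ × ℝ)) (u v : ℝ × ℝ → ℝ) : Prop :=
  ∀ p ∈ Ω, dx (dy v) p + dx v p * dy v p / (2 * (1 + Real.exp (u p / 2 + v p / 2))) = 0

namespace CauchyData

variable (D : CauchyData)

/-- `(u, v)` is a smooth solution on `Ω` of the Cauchy problem with the given data. -/
structure IsCauchySolution (Ω : Set (ℝ × ℝ)) (u v : ℝ × ℝ → ℝ) : Prop where
  smooth_u : ContDiffOn ℝ ∞ u Ω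
  smooth_v : ContDiffOn ℝ ∞ v Ω
  pde_u : FirstPDE Ω u v
  pde_v : SecondPDE Ω u v
  value_u : ∀ t ∈ D.I, u (D.γ t) = D.φ₁ t
  value_v : ∀ t ∈ D.I, v (D.γ t) = D.φ₂ t
  normal_u : ∀ t ∈ D.I, fderiv ℝ u (D.γ t) (D.n t) = D.ψ₁ t
  normal_v : ∀ t ∈ D.I, fderiv ℝ v (D.γ t) (D.n t) = D.ψ₂ t

/-- `U = (u₁, u₂)` is a wave map on `Ω` into the target metric, with the Cauchy data that
correspond to the given data for `u = u₁ + u₂` and `v = u₁ - u₂`. -/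
structure IsWaveMapCauchySolution (Ω : Set (ℝ × ℝ)) (U : ℝ × ℝ → Fin 2 → ℝ) : Prop where
  waveMap : IsWaveMapOn targetMetric Ω U
  value_fst : ∀ t ∈ D.I, U (D.γ t) 0 = (D.φ₁ t + D.φ₂ t) / 2
  value_snd : ∀ t ∈ D.I, U (D.γ t) 1 = (D.φ₁ t - D.φ₂ t) / 2
  normal_fst : ∀ t ∈ D.I,
    fderiv ℝ (fun p => U p 0) (D.γ t) (D.n t) = (D.ψ₁ t + D.ψ₂ t) / 2
  normal_snd : ∀ t ∈ D.I,
    fderiv ℝ (fun p => U p 1) (D.γ t) (D.n t) = (D.ψ₁ t - D.ψ₂ t) / 2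

/-! ### The Riccati equation and the quadrature -/

/-- `∂Γ/∂y = ½ (k₁(y) + k₂(y) Γ - Γ²)` on `Ω`, and `Γ` on `γ` is the initial value of `u_y`. -/
structure RiccatiIVP (Ω : Set (ℝ × ℝ)) (Γ : ℝ × ℝ → ℝ) : Prop where
  ode : ∀ p ∈ Ω, HasDerivAt (fun s => Γ (p.1, s))
    ((1 / 2) * (D.k₁ p.2 + D.k₂ p.2 * Γ p - Γ p ^ 2)) p.2
  initial : ∀ t ∈ D.I, Γ (D.γ t) = D.uy t

/-- `∂u/∂y = Γ` on `Ω`, and `u = φ₁` on `γ`. -/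
structure Quadrature (Ω : Set (ℝ × ℝ)) (Γ u : ℝ × ℝ → ℝ) : Prop where
  ode : ∀ p ∈ Ω, HasDerivAt (fun s => u (p.1, s)) (Γ p) p.2
  initial : ∀ t ∈ D.I, u (D.γ t) = D.φ₁ t

/-- `Γ`, `u` and `v` are produced on `Ω` by the Riccati initial value problem, the quadrature and
the algebraic recovery of `v` from the first equation. -/
structure IsRiccatiReduction (Ω : Set (ℝ × ℝ)) (Γ u v : ℝ × ℝ → ℝ) : Prop where
  riccati : D.RiccatiIVP Ω Γ
  quadrature : D.Quadrature Ω Γ u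
  recovery : FirstPDE Ω u v

end CauchyData

end WaveMap

end

open scoped ContDiff

noncomputable section

namespace WaveMap

open Set Filter Topology

/-! ### Functions of one variable -/

/-! Write `S = exp (u/2 + v/2)`. For a solution of the system, `β₁ = u_y v_y S / (1 + S)` and `β₃ =
(2 u_yy + u_y² - β₁) / u_y` have vanishing `x`-derivative. Since horizontal slices are intervals
meeting `γ`, these quantities equal `k₁(y)` and `k₂(y)`, and the definition of `β₃` then reads as
the Riccati equation for `u_y`. This gives the converse (`IsCauchySolution.isRiccatiReduction`).

In the other direction, let `Γ = u_y` solve the Riccati problem. Differentiating it in `x` shows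
that `u_xy = Γ_x` solves a homogeneous linear equation in `y`. The choice of `k₂` makes `Γ_y` equal
to the prescribed `u_yy` on `γ`, hence `Γ_x` equal to the prescribed, nonzero `u_xy`; so `u_xy`
vanishes nowhere and the first equation can be solved for `v` (`jets_of_riccati`, `dx_Γ_ne_zero`).
The `y`-derivative of the first equation, combined with the Riccati equation and its `x`-derivative,
yields `β₁ = k₁`; the `x`-derivative of this identity is the second equation, and its value on `γ`
gives the remaining datum `v_y` (`IsRiccatiReduction.first_integral`,
`IsRiccatiReduction.secondPDE`).

Uniqueness is one-dimensional, along vertical lines. The Riccati problem assumes no regularity in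
`x`; smoothness comes from the explicit description of all solutions near a given one
(`riccati_family`, `smooth_of_riccati`). For existence, local solutions near points of `γ` agree on
overlaps and are glued over a union of boxes, which is then shrunk until the expression for `exp
(v/2)` is positive. Passing to `(u+v)/2` and `(u-v)/2` turns the system into the wave map equation
in null coordinates (`waveMap_equation_iff`). -/

theorem eq_of_hasDerivAt_zero {S : Set ℝ} (hS : IsOpen S) (hc : S.OrdConnected) {h : ℝ → ℝ}
    (hd : ∀ y ∈ S, HasDerivAt h 0 y) {a b : ℝ} (ha : a ∈ S) (hb : b ∈ S) : h a = h b :=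
  hS.is_const_of_deriv_eq_zero hc.isPreconnected
    (fun y hy => (hd y hy).differentiableAt.differentiableWithinAt)
    (fun y hy => (hd y hy).deriv) ha hb

theorem exists_antideriv {S : Set ℝ} (hS : IsOpen S) (hc : S.OrdConnected) {A : ℝ → ℝ}
    (hA : ContinuousOn A S) {y₀ : ℝ} (hy₀ : y₀ ∈ S) :
    ∃ B : ℝ → ℝ, B y₀ = 0 ∧ ∀ y ∈ S, HasDerivAt B (A y) y := by
  refine ⟨fun y => ∫ s in y₀..y, A s, by simp, fun y hy => ?_⟩
  refine intervalIntegral.integral_hasDerivAt_right ?_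
    (hA.stronglyMeasurableAtFilter hS y hy) (hA.continuousAt (hS.mem_nhds hy))
  exact (hA.mono (hc.uIcc_subset hy₀ hy)).intervalIntegrable

theorem contDiffOn_infty_of_hasDerivAt {S : Set ℝ} (hS : IsOpen S) {f f' : ℝ → ℝ}
    (hf' : ContDiffOn ℝ ∞ f' S) (h : ∀ y ∈ S, HasDerivAt f (f' y) y) : ContDiffOn ℝ ∞ f S :=
  (contDiffOn_infty_iff_deriv_of_isOpen hS).2
    ⟨fun y hy => (h y hy).differentiableAt.differentiableWithinAt,
      hf'.congr fun y hy => (h y hy).deriv⟩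

/-- Smoothness of the solutions of a smooth scalar ordinary differential equation. -/
theorem contDiffOn_infty_of_ode {S : Set ℝ} (hS : IsOpen S) {f : ℝ → ℝ} {Φ : (ℝ → ℝ) → ℝ → ℝ}
    (hΦ : ∀ n : ℕ, ContDiffOn ℝ n f S → ContDiffOn ℝ n (Φ f) S)
    (h : ∀ y ∈ S, HasDerivAt f (Φ f y) y) : ContDiffOn ℝ ∞ f S := by
  rw [contDiffOn_infty]
  intro n
  induction n with
  | zero =>
    exact contDiffOn_zero.2 fun y hy => (h y hy).continuousAt.continuousWithinAt
  | succ n ih =>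
    rw [Nat.cast_add, Nat.cast_one, contDiffOn_succ_iff_deriv_of_isOpen hS]
    exact ⟨fun y hy => (h y hy).differentiableAt.differentiableWithinAt, by simp,
      (hΦ n ih).congr fun y hy => (h y hy).deriv⟩

/-- A solution of a homogeneous linear equation on an interval vanishes everywhere or nowhere. -/
theorem linear_ode_eq_mul {S : Set ℝ} (hS : IsOpen S) (hc : S.OrdConnected) {A g : ℝ → ℝ}
    (hA : ContinuousOn A S) (hg : ∀ y ∈ S, HasDerivAt g (A y * g y) y) {a b : ℝ} (ha : a ∈ S)
    (hb : b ∈ S) : ∃ c : ℝ, c ≠ 0 ∧ g b = c * g a := by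
  obtain ⟨B, hB0, hB⟩ := exists_antideriv hS hc hA ha
  have key := eq_of_hasDerivAt_zero hS hc (h := fun y => g y * Real.exp (-B y))
    (fun y hy => by
      have := (hg y hy).mul (hB y hy).neg.exp
      refine this.congr_deriv ?_
      ring) ha hb
  simp only [hB0, neg_zero, Real.exp_zero, mul_one] at key
  refine ⟨Real.exp (B b), Real.exp_ne_zero _, ?_⟩
  rw [key, mul_left_comm, ← Real.exp_add]
  simp

theorem linear_ode_eq_zero {S : Set ℝ} (hS : IsOpen S) (hc : S.OrdConnected) {A g : ℝ → ℝ}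
    (hA : ContinuousOn A S) (hg : ∀ y ∈ S, HasDerivAt g (A y * g y) y) {a : ℝ} (ha : a ∈ S)
    (h0 : g a = 0) {b : ℝ} (hb : b ∈ S) : g b = 0 := by
  obtain ⟨c, -, h⟩ := linear_ode_eq_mul hS hc hA hg ha hb
  rw [h, h0, mul_zero]

theorem linear_ode_ne_zero {S : Set ℝ} (hS : IsOpen S) (hc : S.OrdConnected) {A g : ℝ → ℝ}
    (hA : ContinuousOn A S) (hg : ∀ y ∈ S, HasDerivAt g (A y * g y) y) {a : ℝ} (ha : a ∈ S)
    (h0 : g a ≠ 0) {b : ℝ} (hb : b ∈ S) : g b ≠ 0 := by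
  obtain ⟨c, hc0, h⟩ := linear_ode_eq_mul hS hc hA hg ha hb
  rw [h]
  exact mul_ne_zero hc0 h0

/-- The difference of two solutions satisfies a homogeneous linear equation with coefficient `(q -
g₁ - g₂) / 2`, so it vanishes identically once it vanishes at one point. -/
theorem riccati_unique {S : Set ℝ} (hS : IsOpen S) (hc : S.OrdConnected) {p q g₁ g₂ : ℝ → ℝ}
    (hq : ContinuousOn q S)
    (h₁ : ∀ y ∈ S, HasDerivAt g₁ ((1 / 2) * (p y + q y * g₁ y - g₁ y ^ 2)) y)
    (h₂ : ∀ y ∈ S, HasDerivAt g₂ ((1 / 2) * (p y + q y * g₂ y - g₂ y ^ 2)) y)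
    {a : ℝ} (ha : a ∈ S) (h0 : g₁ a = g₂ a) {b : ℝ} (hb : b ∈ S) : g₁ b = g₂ b := by
  have c₁ : ContinuousOn g₁ S := fun y hy => (h₁ y hy).continuousAt.continuousWithinAt
  have c₂ : ContinuousOn g₂ S := fun y hy => (h₂ y hy).continuousAt.continuousWithinAt
  refine sub_eq_zero.1 (linear_ode_eq_zero hS hc (g := fun y => g₁ y - g₂ y)
    (A := fun y => (1 / 2) * (q y - g₁ y - g₂ y)) (by fun_prop) (fun y hy => ?_) ha
    (sub_eq_zero.2 h0) hb)
  refine ((h₁ y hy).sub (h₂ y hy)).congr_deriv ?_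
  ring

theorem quadrature_unique {S : Set ℝ} (hS : IsOpen S) (hc : S.OrdConnected) {g u₁ u₂ : ℝ → ℝ}
    (h₁ : ∀ y ∈ S, HasDerivAt u₁ (g y) y) (h₂ : ∀ y ∈ S, HasDerivAt u₂ (g y) y)
    {a : ℝ} (ha : a ∈ S) (h0 : u₁ a = u₂ a) {b : ℝ} (hb : b ∈ S) : u₁ b = u₂ b := by
  have := eq_of_hasDerivAt_zero hS hc (h := fun y => u₁ y - u₂ y)
    (fun y hy => ((h₁ y hy).sub (h₂ y hy)).congr_deriv (sub_self _)) ha hb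
  simp only [h0, sub_self] at this
  linarith

/-- Adjoining the trivial equation `y' = 1` makes the problem autonomous, so that Picard–Lindelöf
for a `C¹` vector field on the plane applies. -/
theorem riccati_exists_local {p q : ℝ → ℝ} {y₀ : ℝ} (hp : ContDiffAt ℝ ∞ p y₀)
    (hq : ContDiffAt ℝ ∞ q y₀) (z₀ : ℝ) :
    ∃ g : ℝ → ℝ, g y₀ = z₀ ∧ ∃ ε > 0, ∀ y ∈ Ioo (y₀ - ε) (y₀ + ε),
      HasDerivAt g ((1 / 2) * (p y + q y * g y - g y ^ 2)) y := by
  have hF : ContDiffAt ℝ 1 (fun w : ℝ × ℝ =>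
      ((1 : ℝ), (1 / 2) * (p w.1 + q w.1 * w.2 - w.2 ^ 2))) (y₀, z₀) := by
    have hp' : ContDiffAt ℝ 1 (fun w : ℝ × ℝ => p w.1) (y₀, z₀) :=
      ContDiffAt.comp (g := p) (y₀, z₀) (hp.of_le (by simp)) contDiffAt_fst
    have hq' : ContDiffAt ℝ 1 (fun w : ℝ × ℝ => q w.1) (y₀, z₀) :=
      ContDiffAt.comp (g := q) (y₀, z₀) (hq.of_le (by simp)) contDiffAt_fst
    exact contDiffAt_const.prodMk (contDiffAt_const.mul
      ((hp'.add (hq'.mul contDiffAt_snd)).sub (contDiffAt_snd.pow 2)))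
  obtain ⟨α, hα0, ε, hε, hα⟩ :=
    hF.exists_forall_mem_closedBall_exists_eq_forall_mem_Ioo_hasDerivAt₀ y₀
  have hfst : ∀ y ∈ Ioo (y₀ - ε) (y₀ + ε), (α y).1 = y := fun y hy => by
    refine quadrature_unique isOpen_Ioo ordConnected_Ioo (g := fun _ => 1)
      (u₁ := fun y => (α y).1) (fun s hs => ?_) (fun s _ => hasDerivAt_id' s)
      (a := y₀) ⟨by linarith, by linarith⟩ (by rw [hα0]) hy
    exact (hα s hs).fst
  refine ⟨fun y => (α y).2, by simp only [hα0], ε, hε, fun y hy => ?_⟩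
  have : HasDerivAt (fun y => (α y).2) _ y := (hα y hy).snd
  simpa only [hfst y hy] using this

/-! ### Inverse functions on an interval -/

section Inverse

variable {I : Set ℝ} {g : ℝ → ℝ}

theorem injOn_of_deriv_ne_zero (hc : I.OrdConnected)
    (hg : ∀ t ∈ I, DifferentiableAt ℝ g t) (hd : ∀ t ∈ I, deriv g t ≠ 0) : InjOn g I := by
  have aux : ∀ a ∈ I, ∀ b ∈ I, a < b → g a ≠ g b := fun a ha b hb hab h => by
    have hsub : Icc a b ⊆ I := hc.out ha hb
    obtain ⟨c, hc, hc0⟩ := exists_deriv_eq_zero hab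
      (fun t ht => (hg t (hsub ht)).continuousAt.continuousWithinAt) h
    exact hd c (hsub (Ioo_subset_Icc_self hc)) hc0
  intro a ha b hb h
  rcases lt_trichotomy a b with h1 | h1 | h1
  · exact absurd h (aux a ha b hb h1)
  · exact h1
  · exact absurd h.symm (aux b hb a ha h1)

theorem exists_contDiffAt_local_inverse (hI : IsOpen I) (hg : ContDiffOn ℝ ∞ g I)
    (hd : ∀ t ∈ I, deriv g t ≠ 0) {t : ℝ} (ht : t ∈ I) :
    ∃ h : ℝ → ℝ, ContDiffAt ℝ ∞ h (g t) ∧ h (g t) = t ∧ ∀ᶠ y in 𝓝 (g t), h y ∈ I ∧ g (h y) = y := by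
  have hgt : ContDiffAt ℝ ∞ g t := hg.contDiffAt (hI.mem_nhds ht)
  have hder : HasDerivAt g (deriv g t) t := (hgt.differentiableAt (by simp)).hasDerivAt
  have hder' := hder.hasFDerivAt_equiv (hd t ht)
  refine ⟨hgt.localInverse hder' (by simp), hgt.to_localInverse hder' (by simp),
    hgt.localInverse_apply_image hder' (by simp), ?_⟩
  have hc := (hgt.to_localInverse hder' (by simp)).continuousAt
  have hmem : ∀ᶠ y in 𝓝 (g t), hgt.localInverse hder' (by simp) y ∈ I := by
    apply hc
    rw [hgt.localInverse_apply_image hder' (by simp)]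
    exact hI.mem_nhds ht
  exact hmem.and (hgt.hasStrictFDerivAt' hder' (by simp)).eventually_right_inverse

theorem isOpen_image_of_deriv_ne_zero (hI : IsOpen I) (hg : ContDiffOn ℝ ∞ g I)
    (hd : ∀ t ∈ I, deriv g t ≠ 0) : IsOpen (g '' I) := by
  rw [isOpen_iff_mem_nhds]
  rintro _ ⟨t, ht, rfl⟩
  obtain ⟨h, -, -, hh⟩ := exists_contDiffAt_local_inverse hI hg hd ht
  filter_upwards [hh] with y hy using ⟨h y, hy.1, hy.2⟩

/-- By Rolle's theorem `g` is injective on `I`, so the global inverse agrees near each image point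
with the smooth local inverse of the inverse function theorem. -/
theorem contDiffOn_invFunOn (hI : IsOpen I) (hc : I.OrdConnected) (hg : ContDiffOn ℝ ∞ g I)
    (hd : ∀ t ∈ I, deriv g t ≠ 0) : ContDiffOn ℝ ∞ (Function.invFunOn g I) (g '' I) := by
  have hinj := injOn_of_deriv_ne_zero hc
    (fun t ht => (hg.contDiffAt (hI.mem_nhds ht)).differentiableAt (by simp)) hd
  rintro _ ⟨t, ht, rfl⟩
  obtain ⟨h, hsm, -, hh⟩ := exists_contDiffAt_local_inverse hI hg hd ht
  refine (hsm.congr_of_eventuallyEq ?_).contDiffWithinAt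
  filter_upwards [hh] with y hy
  have := hinj.leftInvOn_invFunOn hy.1
  rwa [hy.2] at this

theorem ordConnected_image_of_continuousOn (hc : I.OrdConnected) (hg : ContinuousOn g I) :
    (g '' I).OrdConnected :=
  (hc.isPreconnected.image g hg).ordConnected

end Inverse

/-! ### Partial derivatives -/

section Partial

variable {Ω : Set (ℝ × ℝ)} {f g : ℝ × ℝ → ℝ} {p : ℝ × ℝ}

theorem hasDerivAt_fst_line {f' : ℝ × ℝ →L[ℝ] ℝ} (h : HasFDerivAt f f' p) :
    HasDerivAt (fun s => f (s, p.2)) (f' (1, 0)) p.1 :=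
  HasFDerivAt.comp_hasDerivAt (l := f) p.1 (f := fun s => (s, p.2)) h
    ((hasDerivAt_id' p.1).prodMk (hasDerivAt_const p.1 p.2))

theorem hasDerivAt_snd_line {f' : ℝ × ℝ →L[ℝ] ℝ} (h : HasFDerivAt f f' p) :
    HasDerivAt (fun s => f (p.1, s)) (f' (0, 1)) p.2 :=
  HasFDerivAt.comp_hasDerivAt (l := f) p.2 (f := fun s => (p.1, s)) h
    ((hasDerivAt_const p.2 p.1).prodMk (hasDerivAt_id' p.2))

theorem dx_eq_fderiv (h : DifferentiableAt ℝ f p) : dx f p = fderiv ℝ f p (1, 0) :=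
  (hasDerivAt_fst_line h.hasFDerivAt).deriv

theorem dy_eq_fderiv (h : DifferentiableAt ℝ f p) : dy f p = fderiv ℝ f p (0, 1) :=
  (hasDerivAt_snd_line h.hasFDerivAt).deriv

theorem fderiv_apply_eq (h : DifferentiableAt ℝ f p) (w : ℝ × ℝ) :
    fderiv ℝ f p w = dx f p * w.1 + dy f p * w.2 := by
  rw [dx_eq_fderiv h, dy_eq_fderiv h]
  have : w = w.1 • ((1 : ℝ), (0 : ℝ)) + w.2 • ((0 : ℝ), (1 : ℝ)) := by
    ext <;> simp
  conv_lhs => rw [this, map_add, map_smul, map_smul]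
  simp only [smul_eq_mul]
  ring

variable (hΩ : IsOpen Ω)
include hΩ

theorem differentiableAt_of_smoothOn (hf : ContDiffOn ℝ ∞ f Ω) (hp : p ∈ Ω) :
    DifferentiableAt ℝ f p :=
  (hf.contDiffAt (hΩ.mem_nhds hp)).differentiableAt (by simp)

theorem hasDerivAt_dx (hf : ContDiffOn ℝ ∞ f Ω) (hp : p ∈ Ω) :
    HasDerivAt (fun s => f (s, p.2)) (dx f p) p.1 :=
  (hasDerivAt_fst_line (differentiableAt_of_smoothOn hΩ hf hp).hasFDerivAt).differentiableAt.hasDerivAt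

theorem hasDerivAt_dy (hf : ContDiffOn ℝ ∞ f Ω) (hp : p ∈ Ω) :
    HasDerivAt (fun s => f (p.1, s)) (dy f p) p.2 :=
  (hasDerivAt_snd_line (differentiableAt_of_smoothOn hΩ hf hp).hasFDerivAt).differentiableAt.hasDerivAt

theorem contDiffOn_fderiv_apply (hf : ContDiffOn ℝ ∞ f Ω) (w : ℝ × ℝ) :
    ContDiffOn ℝ ∞ (fun p => fderiv ℝ f p w) Ω :=
  (hf.fderiv_of_isOpen hΩ (m := ∞) (by simp)).clm_apply contDiffOn_const

theorem contDiffOn_dx (hf : ContDiffOn ℝ ∞ f Ω) : ContDiffOn ℝ ∞ (dx f) Ω :=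
  (contDiffOn_fderiv_apply hΩ hf (1, 0)).congr
    fun _ hp => dx_eq_fderiv (differentiableAt_of_smoothOn hΩ hf hp)

theorem contDiffOn_dy (hf : ContDiffOn ℝ ∞ f Ω) : ContDiffOn ℝ ∞ (dy f) Ω :=
  (contDiffOn_fderiv_apply hΩ hf (0, 1)).congr
    fun _ hp => dy_eq_fderiv (differentiableAt_of_smoothOn hΩ hf hp)

theorem dx_congr (h : EqOn f g Ω) (hp : p ∈ Ω) : dx f p = dx g p := by
  have hc : Tendsto (fun s : ℝ => (s, p.2)) (𝓝 p.1) (𝓝 p) :=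
    Continuous.tendsto (f := fun s : ℝ => (s, p.2)) (by fun_prop) p.1
  exact Filter.EventuallyEq.deriv_eq ((hc.eventually (hΩ.mem_nhds hp)).mono fun s hs => h hs)

theorem dy_congr (h : EqOn f g Ω) (hp : p ∈ Ω) : dy f p = dy g p := by
  have hc : Tendsto (fun s : ℝ => (p.1, s)) (𝓝 p.2) (𝓝 p) :=
    Continuous.tendsto (f := fun s : ℝ => (p.1, s)) (by fun_prop) p.2
  exact Filter.EventuallyEq.deriv_eq ((hc.eventually (hΩ.mem_nhds hp)).mono fun s hs => h hs)

theorem dx_dy_comm (hf : ContDiffOn ℝ ∞ f Ω) (hp : p ∈ Ω) : dx (dy f) p = dy (dx f) p := by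
  have hfd : ∀ q ∈ Ω, DifferentiableAt ℝ f q := fun q hq => differentiableAt_of_smoothOn hΩ hf hq
  have hf2 : DifferentiableAt ℝ (fderiv ℝ f) p :=
    ((hf.fderiv_of_isOpen hΩ (m := ∞) (by simp)).contDiffAt (hΩ.mem_nhds hp)).differentiableAt
      (by simp)
  have key : ∀ w z : ℝ × ℝ, fderiv ℝ (fun q => fderiv ℝ f q w) p z
      = fderiv ℝ (fderiv ℝ f) p z w := fun w z => by
    rw [fderiv_clm_apply hf2 (differentiableAt_const w)]
    simp
  have hd : ∀ w : ℝ × ℝ, DifferentiableAt ℝ (fun q => fderiv ℝ f q w) p := fun w =>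
    differentiableAt_of_smoothOn hΩ (contDiffOn_fderiv_apply hΩ hf w) hp
  rw [dx_congr hΩ (fun q hq => dy_eq_fderiv (hfd q hq)) hp,
    dy_congr hΩ (fun q hq => dx_eq_fderiv (hfd q hq)) hp, dx_eq_fderiv (hd _),
    dy_eq_fderiv (hd _), key, key]
  exact ((hf.contDiffAt (hΩ.mem_nhds hp)).isSymmSndFDerivAt (by simpa using ENat.LEInfty.out)).eq _ _

theorem isOpen_horizontal (y : ℝ) : IsOpen {x : ℝ | (x, y) ∈ Ω} :=
  hΩ.preimage (by fun_prop : Continuous fun x : ℝ => (x, y))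

theorem isOpen_vertical (x : ℝ) : IsOpen {y : ℝ | (x, y) ∈ Ω} :=
  hΩ.preimage (by fun_prop : Continuous fun y : ℝ => (x, y))

end Partial

/-! ### Riccati equations with parameters -/

theorem exists_Icc_subset {V : Set ℝ} (hV : IsOpen V) (hc : V.OrdConnected) {y₀ y₁ : ℝ}
    (h₀ : y₀ ∈ V) (h₁ : y₁ ∈ V) :
    ∃ a b, y₀ ∈ Ioo a b ∧ y₁ ∈ Ioo a b ∧ Icc a b ⊆ V := by
  have hmin : min y₀ y₁ ∈ V := by rcases min_choice y₀ y₁ with h | h <;> rwa [h]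
  have hmax : max y₀ y₁ ∈ V := by rcases max_choice y₀ y₁ with h | h <;> rwa [h]
  obtain ⟨a, ha, haV⟩ := (nhdsLT_neBot (min y₀ y₁)).nonempty_of_mem
    (inter_mem self_mem_nhdsWithin (mem_nhdsWithin_of_mem_nhds (hV.mem_nhds hmin)))
  obtain ⟨b, hb, hbV⟩ := (nhdsGT_neBot (max y₀ y₁)).nonempty_of_mem
    (inter_mem self_mem_nhdsWithin (mem_nhdsWithin_of_mem_nhds (hV.mem_nhds hmax)))
  rw [mem_Iio, lt_min_iff] at ha
  rw [mem_Ioi, max_lt_iff] at hb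
  exact ⟨a, b, ⟨ha.1, hb.1⟩, ⟨ha.2, hb.2⟩, hc.out haV hbV⟩

/-- All solutions of a Riccati equation near a given one `Γ₀` are obtained from `Γ₀` by two
quadratures, and so is their integral. Hence they depend smoothly on the initial data. -/
theorem riccati_family {V : Set ℝ} (hV : IsOpen V) (hc : V.OrdConnected) {p q Γ₀ u₀ : ℝ → ℝ}
    (hp : ContDiffOn ℝ ∞ p V) (hq : ContDiffOn ℝ ∞ q V)
    (hΓ₀ : ∀ y ∈ V, HasDerivAt Γ₀ ((1 / 2) * (p y + q y * Γ₀ y - Γ₀ y ^ 2)) y)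
    (hu₀ : ∀ y ∈ V, HasDerivAt u₀ (Γ₀ y) y) {f ζ φ : ℝ → ℝ} {x₀ : ℝ}
    (hf : ContDiffAt ℝ ∞ f x₀) (hζ : ContDiffAt ℝ ∞ ζ x₀) (hφ : ContDiffAt ℝ ∞ φ x₀)
    (hfV : f x₀ ∈ V) (hΓf : Γ₀ (f x₀) = ζ x₀) {y₁ : ℝ} (hy₁ : y₁ ∈ V) :
    ∃ a b, y₁ ∈ Ioo a b ∧ Icc a b ⊆ V ∧ ∃ G w : ℝ × ℝ → ℝ,
      ContDiffAt ℝ ∞ G (x₀, y₁) ∧ ContDiffAt ℝ ∞ w (x₀, y₁) ∧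
      ∀ᶠ x in 𝓝 x₀, f x ∈ Ioo a b ∧ G (x, f x) = ζ x ∧ w (x, f x) = φ x ∧
        ∀ y ∈ Ioo a b,
          HasDerivAt (fun s => G (x, s)) ((1 / 2) * (p y + q y * G (x, y) - G (x, y) ^ 2)) y ∧
          HasDerivAt (fun s => w (x, s)) (G (x, y)) y := by
  have sΓ : ContDiffOn ℝ ∞ Γ₀ V :=
    contDiffOn_infty_of_ode hV (Φ := fun g y => (1 / 2) * (p y + q y * g y - g y ^ 2))
      (fun n hn => by
        have hpn : ContDiffOn ℝ n p V := hp.of_le (mod_cast le_top)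
        have hqn : ContDiffOn ℝ n q V := hq.of_le (mod_cast le_top)
        fun_prop) hΓ₀
  have su : ContDiffOn ℝ ∞ u₀ V := contDiffOn_infty_of_hasDerivAt hV sΓ hu₀
  -- A second solution `Γ₀ + g` requires `g' = (q/2 - Γ₀) g - g²/2`, which is linear in `1/g`. With
  -- `K' = q/2 - Γ₀` and `F' = exp K` this gives `g = c exp K / (1 + c F / 2)`, whose antiderivative
  -- is `2 log (1 + c F / 2)`.
  have sA : ContDiffOn ℝ ∞ (fun y => (1 / 2) * q y - Γ₀ y) V := by fun_prop
  obtain ⟨K, hK0, hK⟩ := exists_antideriv hV hc sA.continuousOn hfV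
  have sK : ContDiffOn ℝ ∞ K V := contDiffOn_infty_of_hasDerivAt hV sA hK
  have sE : ContDiffOn ℝ ∞ (fun y => Real.exp (K y)) V := sK.exp
  obtain ⟨F, hF0, hF⟩ := exists_antideriv hV hc sE.continuousOn hfV
  have sF : ContDiffOn ℝ ∞ F V := contDiffOn_infty_of_hasDerivAt hV sE hF
  obtain ⟨a, b, hfab, hyab, hab⟩ := exists_Icc_subset hV hc hfV hy₁
  have atV : ∀ {h : ℝ → ℝ} {y : ℝ}, ContDiffOn ℝ ∞ h V → y ∈ V → ContDiffAt ℝ ∞ h y :=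
    fun h hy => h.contDiffAt (hV.mem_nhds hy)
  have cf : ∀ {h : ℝ → ℝ}, ContDiffOn ℝ ∞ h V → ContDiffAt ℝ ∞ (fun x => h (f x)) x₀ :=
    fun h => (atV h hfV).comp x₀ hf
  set δ : ℝ → ℝ := fun x => ζ x - Γ₀ (f x) with hδ
  have sδ : ContDiffAt ℝ ∞ δ x₀ := hζ.sub (cf sΓ)
  have δ0 : δ x₀ = 0 := by simp [hδ, hΓf]
  -- The condition `g = δ x` at `y = f x` is linear in `c`, with solution `c = δ / den`. At `x₀` the
  -- solution is `Γ₀` itself, so `c x₀ = 0`.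
  set den : ℝ → ℝ := fun x => Real.exp (K (f x)) - δ x * F (f x) / 2 with hden
  have sden : ContDiffAt ℝ ∞ den x₀ := (cf sE).sub ((sδ.mul (cf sF)).div_const 2)
  have den0 : den x₀ = 1 := by simp [hden, hK0, hF0]
  set c : ℝ → ℝ := fun x => δ x / den x with hcdef
  have sc : ContDiffAt ℝ ∞ c x₀ := sδ.div sden (by rw [den0]; exact one_ne_zero)
  have c0 : c x₀ = 0 := by simp [hcdef, δ0]
  -- The bound on `F` over the compact interval keeps `1 + c x * F y / 2` positive for all its `y`
  -- at once, as soon as `x` is near `x₀`.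
  obtain ⟨M, hM⟩ := isCompact_Icc.exists_bound_of_continuousOn (sF.continuousOn.mono hab)
  have hsmall : ∀ᶠ x in 𝓝 x₀, |c x| * M < 1 := by
    have : ContinuousAt (fun x => |c x| * M) x₀ := sc.continuousAt.abs.mul continuousAt_const
    refine this.eventually_lt continuousAt_const ?_
    simp [c0]
  have hden_ne : ∀ᶠ x in 𝓝 x₀, den x ≠ 0 :=
    sden.continuousAt.eventually_ne (by rw [den0]; exact one_ne_zero)
  have hfx : ∀ᶠ x in 𝓝 x₀, f x ∈ Ioo a b := hf.continuousAt (isOpen_Ioo.mem_nhds hfab)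
  have hpos : ∀ x, |c x| * M < 1 → ∀ y ∈ Icc a b, 0 < 1 + c x * F y / 2 := fun x hx y hy => by
    have h1 : |c x * F y| ≤ |c x| * M := by
      rw [abs_mul]
      exact mul_le_mul_of_nonneg_left (hM y hy) (abs_nonneg _)
    have := neg_abs_le (c x * F y)
    linarith
  have sfst : ∀ {h : ℝ → ℝ}, ContDiffAt ℝ ∞ h x₀ →
      ContDiffAt ℝ ∞ (fun r : ℝ × ℝ => h r.1) (x₀, y₁) :=
    fun h => ContDiffAt.comp (x₀, y₁) (g := _) (f := Prod.fst) h contDiffAt_fst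
  have ssnd : ∀ {h : ℝ → ℝ}, ContDiffOn ℝ ∞ h V →
      ContDiffAt ℝ ∞ (fun r : ℝ × ℝ => h r.2) (x₀, y₁) :=
    fun h => ContDiffAt.comp (x₀, y₁) (g := _) (f := Prod.snd) (atV h hy₁) contDiffAt_snd
  have sden2 : ContDiffAt ℝ ∞ (fun r : ℝ × ℝ => 1 + c r.1 * F r.2 / 2) (x₀, y₁) :=
    contDiffAt_const.add (((sfst sc).mul (ssnd sF)).div_const 2)
  have slogf : ContDiffAt ℝ ∞ (fun x => Real.log (1 + c x * F (f x) / 2)) x₀ :=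
    (contDiffAt_const.add ((sc.mul (cf sF)).div_const 2)).log (by simp [c0])
  refine ⟨a, b, hyab, hab,
    fun r => Γ₀ r.2 + c r.1 * Real.exp (K r.2) / (1 + c r.1 * F r.2 / 2),
    fun r => u₀ r.2 + 2 * Real.log (1 + c r.1 * F r.2 / 2)
      + (φ r.1 - u₀ (f r.1) - 2 * Real.log (1 + c r.1 * F (f r.1) / 2)), ?_, ?_, ?_⟩
  · exact (ssnd sΓ).add (((sfst sc).mul (ssnd sE)).div sden2 (by simp [c0]))
  · exact ((ssnd su).add (contDiffAt_const.mul (sden2.log (by simp [c0])))).add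
      (sfst ((hφ.sub (cf su)).sub (contDiffAt_const.mul slogf)))
  · filter_upwards [hsmall, hden_ne, hfx] with x hx hdx hfx
    refine ⟨hfx, ?_, by ring, fun y hy => ?_⟩
    · have h1 : 1 + c x * F (f x) / 2 = Real.exp (K (f x)) / den x := by
        simp only [hcdef]
        field_simp
        simp only [hden]
        ring
      have h2 := Real.exp_ne_zero (K (f x))
      simp only [h1]
      simp only [hcdef]
      field_simp
      simp only [hδ]
      ring
    · have hyV := hab (Ioo_subset_Icc_self hy)
      have hne := (hpos x hx y (Ioo_subset_Icc_self hy)).ne'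
      have d1 : HasDerivAt (fun s => 1 + c x * F s / 2) (c x * Real.exp (K y) / 2) y :=
        (((hF y hyV).const_mul (c x)).div_const 2).const_add 1
      have hne' : 2 + c x * F y ≠ 0 := fun h => hne (by linarith)
      constructor
      · refine ((hΓ₀ y hyV).add ((((hK y hyV).exp).const_mul (c x)).div d1 hne)).congr_deriv ?_
        field_simp
        ring
      · refine (((hu₀ y hyV).add ((d1.log hne).const_mul 2)).add_const _).congr_deriv ?_
        field_simp

namespace CauchyData

variable (D : CauchyData)

/-! ### The curve and the coefficients -/

theorem hasDerivAt_γ {t : ℝ} (ht : t ∈ D.I) : HasDerivAt D.γ (deriv D.γ t) t :=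
  ((D.smooth_γ.contDiffAt (D.isOpen_I.mem_nhds ht)).differentiableAt (by simp)).hasDerivAt

theorem hasDerivAt_fst {t : ℝ} (ht : t ∈ D.I) :
    HasDerivAt (fun s => (D.γ s).1) (deriv D.γ t).1 t :=
  (D.hasDerivAt_γ ht).fst

theorem hasDerivAt_snd {t : ℝ} (ht : t ∈ D.I) :
    HasDerivAt (fun s => (D.γ s).2) (deriv D.γ t).2 t :=
  (D.hasDerivAt_γ ht).snd

theorem smooth_fst : ContDiffOn ℝ ∞ (fun s => (D.γ s).1) D.I := D.smooth_γ.fst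

theorem smooth_snd : ContDiffOn ℝ ∞ (fun s => (D.γ s).2) D.I := D.smooth_γ.snd

theorem deriv_fst_ne_zero : ∀ t ∈ D.I, deriv (fun s => (D.γ s).1) t ≠ 0 := fun t ht => by
  rw [(D.hasDerivAt_fst ht).deriv]
  exact D.tangent_fst t ht

theorem deriv_snd_ne_zero : ∀ t ∈ D.I, deriv (fun s => (D.γ s).2) t ≠ 0 := fun t ht => by
  rw [(D.hasDerivAt_snd ht).deriv]
  exact D.tangent_snd t ht

theorem injOn_fst : InjOn (fun s => (D.γ s).1) D.I :=
  injOn_of_deriv_ne_zero D.ordConnected_I (fun _ ht => (D.hasDerivAt_fst ht).differentiableAt)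
    D.deriv_fst_ne_zero

theorem injOn_snd : InjOn (fun s => (D.γ s).2) D.I :=
  injOn_of_deriv_ne_zero D.ordConnected_I (fun _ ht => (D.hasDerivAt_snd ht).differentiableAt)
    D.deriv_snd_ne_zero

/-- The parameter of the point of `γ` with abscissa `x`. -/
def paramAtFst (x : ℝ) : ℝ := Function.invFunOn (fun t => (D.γ t).1) D.I x

/-- The projection of `γ` to the `x`-axis. -/
def xRange : Set ℝ := (fun t => (D.γ t).1) '' D.I

/-- The projection of `γ` to the `y`-axis. -/
def yRange : Set ℝ := (fun t => (D.γ t).2) '' D.I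

theorem isOpen_xRange : IsOpen D.xRange :=
  isOpen_image_of_deriv_ne_zero D.isOpen_I D.smooth_fst D.deriv_fst_ne_zero

theorem isOpen_yRange : IsOpen D.yRange :=
  isOpen_image_of_deriv_ne_zero D.isOpen_I D.smooth_snd D.deriv_snd_ne_zero

theorem paramAtFst_fst {t : ℝ} (ht : t ∈ D.I) : D.paramAtFst (D.γ t).1 = t :=
  D.injOn_fst.leftInvOn_invFunOn ht

theorem paramAt_snd {t : ℝ} (ht : t ∈ D.I) : D.paramAt (D.γ t).2 = t :=
  D.injOn_snd.leftInvOn_invFunOn ht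

theorem smooth_paramAtFst : ContDiffOn ℝ ∞ D.paramAtFst D.xRange :=
  contDiffOn_invFunOn D.isOpen_I D.ordConnected_I D.smooth_fst D.deriv_fst_ne_zero

theorem smooth_paramAt : ContDiffOn ℝ ∞ D.paramAt D.yRange :=
  contDiffOn_invFunOn D.isOpen_I D.ordConnected_I D.smooth_snd D.deriv_snd_ne_zero

theorem paramAtFst_mem {x : ℝ} (hx : x ∈ D.xRange) : D.paramAtFst x ∈ D.I := by
  obtain ⟨t, ht, rfl⟩ := hx
  simpa only [D.paramAtFst_fst ht] using ht

theorem paramAt_mem {y : ℝ} (hy : y ∈ D.yRange) : D.paramAt y ∈ D.I := by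
  obtain ⟨t, ht, rfl⟩ := hy
  simpa only [D.paramAt_snd ht] using ht

theorem smooth_deriv {E : Type*} [NormedAddCommGroup E] [NormedSpace ℝ E] {g : ℝ → E}
    (hg : ContDiffOn ℝ ∞ g D.I) : ContDiffOn ℝ ∞ (deriv g) D.I :=
  ((contDiffOn_infty_iff_deriv_of_isOpen D.isOpen_I).1 hg).2

theorem smooth_jetX {φ ψ : ℝ → ℝ} (hφ : ContDiffOn ℝ ∞ φ D.I) (hψ : ContDiffOn ℝ ∞ ψ D.I) :
    ContDiffOn ℝ ∞ (D.jetX φ ψ) D.I := by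
  have h1 := D.smooth_deriv D.smooth_γ
  have h2 := D.smooth_deriv hφ
  have h3 := D.smooth_n
  exact ((h2.mul h3.snd).sub (h1.snd.mul hψ)).div ((h1.fst.mul h3.snd).sub (h1.snd.mul h3.fst))
    D.transverse

theorem smooth_jetY {φ ψ : ℝ → ℝ} (hφ : ContDiffOn ℝ ∞ φ D.I) (hψ : ContDiffOn ℝ ∞ ψ D.I) :
    ContDiffOn ℝ ∞ (D.jetY φ ψ) D.I := by
  have h1 := D.smooth_deriv D.smooth_γ
  have h2 := D.smooth_deriv hφ
  have h3 := D.smooth_n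
  exact ((h1.fst.mul hψ).sub (h2.mul h3.fst)).div ((h1.fst.mul h3.snd).sub (h1.snd.mul h3.fst))
    D.transverse

theorem jet_tangent (φ ψ : ℝ → ℝ) {t : ℝ} (ht : t ∈ D.I) :
    D.jetX φ ψ t * (deriv D.γ t).1 + D.jetY φ ψ t * (deriv D.γ t).2 = deriv φ t := by
  rw [jetX, jetY, div_mul_eq_mul_div, div_mul_eq_mul_div, ← add_div,
    div_eq_iff (D.transverse t ht)]
  ring

theorem jet_normal (φ ψ : ℝ → ℝ) {t : ℝ} (ht : t ∈ D.I) :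
    D.jetX φ ψ t * (D.n t).1 + D.jetY φ ψ t * (D.n t).2 = ψ t := by
  rw [jetX, jetY, div_mul_eq_mul_div, div_mul_eq_mul_div, ← add_div,
    div_eq_iff (D.transverse t ht)]
  ring

theorem smooth_ux : ContDiffOn ℝ ∞ D.ux D.I := D.smooth_jetX D.smooth_φ₁ D.smooth_ψ₁

theorem smooth_uy : ContDiffOn ℝ ∞ D.uy D.I := D.smooth_jetY D.smooth_φ₁ D.smooth_ψ₁

theorem smooth_vy : ContDiffOn ℝ ∞ D.vy D.I := D.smooth_jetY D.smooth_φ₂ D.smooth_ψ₂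

theorem smooth_uxy : ContDiffOn ℝ ∞ D.uxy D.I := by
  refine ((D.smooth_ux.mul D.smooth_uy).div (contDiffOn_const.mul (contDiffOn_const.add
    ((D.smooth_φ₁.div_const 2).add (D.smooth_φ₂.div_const 2)).exp)) fun t _ => ?_).neg
  positivity

theorem smooth_uyy : ContDiffOn ℝ ∞ D.uyy D.I := by
  have h1 := D.smooth_deriv D.smooth_γ
  exact ((D.smooth_deriv D.smooth_uy).sub (D.smooth_uxy.mul h1.fst)).div h1.snd D.tangent_snd

/-- The value of `β₁` along `γ`. -/
def b₁ (t : ℝ) : ℝ := beta₁ (D.φ₁ t) (D.φ₂ t) (D.uy t) (D.vy t)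

/-- The value of `β₃` along `γ`. -/
def b₃ (t : ℝ) : ℝ := beta₃ (D.φ₁ t) (D.φ₂ t) (D.uy t) (D.vy t) (D.uyy t)

theorem k₁_snd {t : ℝ} (ht : t ∈ D.I) : D.k₁ (D.γ t).2 = D.b₁ t := by
  simp only [k₁, b₁, D.paramAt_snd ht]

theorem k₂_snd {t : ℝ} (ht : t ∈ D.I) : D.k₂ (D.γ t).2 = D.b₃ t := by
  simp only [k₂, b₃, D.paramAt_snd ht]

theorem smooth_b₁ : ContDiffOn ℝ ∞ D.b₁ D.I := by
  refine (D.smooth_uy.mul D.smooth_vy).div (contDiffOn_const.add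
    ((D.smooth_φ₁.add D.smooth_φ₂).div_const 2).neg.exp) fun t _ => ?_
  positivity

theorem smooth_b₃ (huy : ∀ t ∈ D.I, D.uy t ≠ 0) : ContDiffOn ℝ ∞ D.b₃ D.I :=
  (((contDiffOn_const.mul D.smooth_uyy).add (D.smooth_uy.pow 2)).sub D.smooth_b₁).div
    D.smooth_uy huy

theorem smooth_k₁ : ContDiffOn ℝ ∞ D.k₁ D.yRange :=
  D.smooth_b₁.comp D.smooth_paramAt fun _ hy => D.paramAt_mem hy

theorem smooth_k₂ (huy : ∀ t ∈ D.I, D.uy t ≠ 0) : ContDiffOn ℝ ∞ D.k₂ D.yRange :=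
  (D.smooth_b₃ huy).comp D.smooth_paramAt fun _ hy => D.paramAt_mem hy

/-- Compatibility of the data: `k₂` is chosen so that the Riccati equation gives the right second
derivative on the curve. -/
theorem uyy_eq (huy : ∀ t ∈ D.I, D.uy t ≠ 0) {t : ℝ} (ht : t ∈ D.I) :
    D.uyy t = (1 / 2) * (D.k₁ (D.γ t).2 + D.k₂ (D.γ t).2 * D.uy t - D.uy t ^ 2) := by
  have := huy t ht
  rw [D.k₁_snd ht, D.k₂_snd ht]
  rw [b₃, beta₃, div_mul_cancel₀ _ this, b₁]
  ring

theorem uxy_ne_zero (hux : ∀ t ∈ D.I, D.ux t ≠ 0) (huy : ∀ t ∈ D.I, D.uy t ≠ 0) {t : ℝ}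
    (ht : t ∈ D.I) : D.uxy t ≠ 0 := by
  have h1 := hux t ht
  have h2 := huy t ht
  exact neg_ne_zero.2 (div_ne_zero (mul_ne_zero h1 h2) (by positivity))

/-! ### Jets along the curve -/

section Jets

variable {D} {Ω : Set (ℝ × ℝ)} (hΩ : D.IsDomain Ω) {f : ℝ × ℝ → ℝ} (hf : ContDiffOn ℝ ∞ f Ω)
  {φ ψ : ℝ → ℝ}
include hΩ hf

theorem deriv_along (hφ : ∀ t ∈ D.I, f (D.γ t) = φ t) {t : ℝ} (ht : t ∈ D.I) :
    dx f (D.γ t) * (deriv D.γ t).1 + dy f (D.γ t) * (deriv D.γ t).2 = deriv φ t := by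
  have hd := differentiableAt_of_smoothOn hΩ.isOpen hf (hΩ.curve_mem t ht)
  have h1 : HasDerivAt (fun s => f (D.γ s)) (fderiv ℝ f (D.γ t) (deriv D.γ t)) t :=
    hd.hasFDerivAt.comp_hasDerivAt t (D.hasDerivAt_γ ht)
  rw [← fderiv_apply_eq hd, ← h1.deriv]
  exact Filter.EventuallyEq.deriv_eq (Filter.mem_of_superset (D.isOpen_I.mem_nhds ht) hφ)

theorem jet_eq (hφ : ∀ t ∈ D.I, f (D.γ t) = φ t)
    (hψ : ∀ t ∈ D.I, fderiv ℝ f (D.γ t) (D.n t) = ψ t) {t : ℝ} (ht : t ∈ D.I) :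
    dx f (D.γ t) = D.jetX φ ψ t ∧ dy f (D.γ t) = D.jetY φ ψ t := by
  have h1 := deriv_along hΩ hf hφ ht
  have h2 := hψ t ht
  rw [fderiv_apply_eq (differentiableAt_of_smoothOn hΩ.isOpen hf (hΩ.curve_mem t ht))] at h2
  have h3 := D.transverse t ht
  constructor
  · rw [jetX, eq_div_iff h3, ← h1, ← h2]
    ring
  · rw [jetY, eq_div_iff h3, ← h1, ← h2]
    ring

/-- The values on `γ` fix the tangential derivative. As `γ₁' ≠ 0`, knowing the `y`-derivative
therefore fixes the `x`-derivative, and with it the derivative along `n`. -/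
theorem normal_of_dy (hφ : ∀ t ∈ D.I, f (D.γ t) = φ t) {t : ℝ} (ht : t ∈ D.I)
    (hy : dy f (D.γ t) = D.jetY φ ψ t) :
    dx f (D.γ t) = D.jetX φ ψ t ∧ fderiv ℝ f (D.γ t) (D.n t) = ψ t := by
  have h1 := deriv_along hΩ hf hφ ht
  rw [fderiv_apply_eq (differentiableAt_of_smoothOn hΩ.isOpen hf (hΩ.curve_mem t ht))]
  have h4 := D.tangent_fst t ht
  have hx : dx f (D.γ t) = D.jetX φ ψ t := by
    apply mul_right_cancel₀ h4
    rw [eq_sub_of_add_eq h1, hy, ← D.jet_tangent φ ψ ht, add_sub_cancel_right]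
  exact ⟨hx, by rw [hx, hy, D.jet_normal φ ψ ht]⟩

end Jets

end CauchyData

namespace CauchyData

variable {D : CauchyData} {Ω : Set (ℝ × ℝ)}

/-! ### Uniqueness and smoothness for the Riccati equation and the quadrature -/

theorem IsDomain.snd_mem_yRange (hΩ : D.IsDomain Ω) {p : ℝ × ℝ} (hp : p ∈ Ω) : p.2 ∈ D.yRange :=
  hΩ.snd_mem p hp

theorem IsDomain.vertical_subset_yRange (hΩ : D.IsDomain Ω) (x : ℝ) :
    {y : ℝ | (x, y) ∈ Ω} ⊆ D.yRange :=
  fun _ hy => hΩ.snd_mem_yRange hy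

/-- The point of `γ` on the vertical line through a point of the domain. -/
theorem IsDomain.exists_vertical (hΩ : D.IsDomain Ω) {p : ℝ × ℝ} (hp : p ∈ Ω) :
    ∃ t ∈ D.I, D.γ t = (p.1, (D.γ t).2) ∧ (p.1, (D.γ t).2) ∈ Ω := by
  obtain ⟨t, ht, h⟩ := hΩ.fst_mem p hp
  have : D.γ t = (p.1, (D.γ t).2) := by rw [← h]
  exact ⟨t, ht, this, this ▸ hΩ.curve_mem t ht⟩

/-- The point of `γ` on the horizontal line through a point of the domain. -/
theorem IsDomain.exists_horizontal (hΩ : D.IsDomain Ω) {p : ℝ × ℝ} (hp : p ∈ Ω) :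
    ∃ t ∈ D.I, D.γ t = ((D.γ t).1, p.2) ∧ ((D.γ t).1, p.2) ∈ Ω := by
  obtain ⟨t, ht, h⟩ := hΩ.snd_mem p hp
  have : D.γ t = ((D.γ t).1, p.2) := by rw [← h]
  exact ⟨t, ht, this, this ▸ hΩ.curve_mem t ht⟩

theorem RiccatiIVP.eqOn (huy : ∀ t ∈ D.I, D.uy t ≠ 0) (hΩ : D.IsDomain Ω) {Γ Γ' : ℝ × ℝ → ℝ}
    (h : D.RiccatiIVP Ω Γ) (h' : D.RiccatiIVP Ω Γ') : EqOn Γ' Γ Ω := by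
  rintro ⟨x, y⟩ hp
  obtain ⟨t, ht, hγ, hmem⟩ := hΩ.exists_vertical hp
  exact riccati_unique (isOpen_vertical hΩ.isOpen x) (hΩ.vertical x) (p := D.k₁) (q := D.k₂)
    (g₁ := fun s => Γ' (x, s)) (g₂ := fun s => Γ (x, s))
    ((D.smooth_k₂ huy).continuousOn.mono (hΩ.vertical_subset_yRange x))
    (fun s hs => h'.ode (x, s) hs) (fun s hs => h.ode (x, s) hs) hmem
    (by simpa only [← hγ] using (h'.initial t ht).trans (h.initial t ht).symm) hp

theorem Quadrature.eqOn (hΩ : D.IsDomain Ω) {Γ Γ' u u' : ℝ × ℝ → ℝ}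
    (h : D.Quadrature Ω Γ u) (h' : D.Quadrature Ω Γ' u') (hΓ : EqOn Γ' Γ Ω) : EqOn u' u Ω := by
  rintro ⟨x, y⟩ hp
  obtain ⟨t, ht, hγ, hmem⟩ := hΩ.exists_vertical hp
  exact quadrature_unique (isOpen_vertical hΩ.isOpen x) (hΩ.vertical x) (g := fun s => Γ (x, s))
    (u₁ := fun s => u' (x, s)) (u₂ := fun s => u (x, s))
    (fun s hs => hΓ hs ▸ h'.ode (x, s) hs) (fun s hs => h.ode (x, s) hs) hmem
    (by simpa only [← hγ] using (h'.initial t ht).trans (h.initial t ht).symm) hp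

/-- The curve as a graph over the `x`-axis. -/
def height (D : CauchyData) (x : ℝ) : ℝ := (D.γ (D.paramAtFst x)).2

theorem smooth_height : ContDiffOn ℝ ∞ D.height D.xRange :=
  D.smooth_snd.comp D.smooth_paramAtFst fun _ hx => D.paramAtFst_mem hx

theorem γ_paramAtFst {x : ℝ} (hx : x ∈ D.xRange) : D.γ (D.paramAtFst x) = (x, D.height x) := by
  obtain ⟨t, ht, rfl⟩ := hx
  simp only [height, D.paramAtFst_fst ht]

theorem height_fst {t : ℝ} (ht : t ∈ D.I) : D.height (D.γ t).1 = (D.γ t).2 := by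
  rw [height, D.paramAtFst_fst ht]

/-- A smooth local model of the solutions of the Riccati equation and the quadrature. -/
theorem exists_local_model (D : CauchyData) (huy : ∀ t ∈ D.I, D.uy t ≠ 0) {V : Set ℝ}
    (hV : IsOpen V) (hc : V.OrdConnected) (hVy : V ⊆ D.yRange) {Γ₀ u₀ : ℝ → ℝ}
    (hΓ₀ : ∀ y ∈ V, HasDerivAt Γ₀ ((1 / 2) * (D.k₁ y + D.k₂ y * Γ₀ y - Γ₀ y ^ 2)) y)
    (hu₀ : ∀ y ∈ V, HasDerivAt u₀ (Γ₀ y) y) {t : ℝ} (ht : t ∈ D.I) (htV : (D.γ t).2 ∈ V)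
    (hΓt : Γ₀ (D.γ t).2 = D.uy t) {y₁ : ℝ} (hy₁ : y₁ ∈ V) :
    ∃ a b, y₁ ∈ Ioo a b ∧ Icc a b ⊆ V ∧ ∃ G w : ℝ × ℝ → ℝ,
      ContDiffAt ℝ ∞ G ((D.γ t).1, y₁) ∧ ContDiffAt ℝ ∞ w ((D.γ t).1, y₁) ∧
      ∀ᶠ x in 𝓝 (D.γ t).1, x ∈ D.xRange ∧ D.height x ∈ Ioo a b ∧
        G (x, D.height x) = D.uy (D.paramAtFst x) ∧ w (x, D.height x) = D.φ₁ (D.paramAtFst x) ∧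
        ∀ y ∈ Ioo a b,
          HasDerivAt (fun s => G (x, s))
            ((1 / 2) * (D.k₁ y + D.k₂ y * G (x, y) - G (x, y) ^ 2)) y ∧
          HasDerivAt (fun s => w (x, s)) (G (x, y)) y := by
  have hx : D.xRange ∈ 𝓝 (D.γ t).1 := D.isOpen_xRange.mem_nhds ⟨t, ht, rfl⟩
  have hcomp : ∀ {h : ℝ → ℝ}, ContDiffOn ℝ ∞ h D.I →
      ContDiffAt ℝ ∞ (fun x => h (D.paramAtFst x)) (D.γ t).1 := fun h =>
    (h.comp D.smooth_paramAtFst fun _ hx => D.paramAtFst_mem hx).contDiffAt hx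
  obtain ⟨a, b, hyab, hab, G, w, sG, sw, hGw⟩ := riccati_family hV hc
    (D.smooth_k₁.mono hVy) ((D.smooth_k₂ huy).mono hVy) hΓ₀ hu₀
    (smooth_height.contDiffAt hx) (hcomp D.smooth_uy) (hcomp D.smooth_φ₁)
    (by rwa [height_fst ht]) (by rwa [height_fst ht, D.paramAtFst_fst ht]) hy₁
  exact ⟨a, b, hyab, hab, G, w, sG, sw, (eventually_mem_set.2 hx).and hGw⟩

/-- The equations constrain each vertical line separately; the lines are tied together only by the
smooth initial values on `γ`. Near each point `Γ` and `u` coincide, by uniqueness on vertical lines,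
with the smooth model built around the solution on the line through that point. -/
theorem smooth_of_riccati (huy : ∀ t ∈ D.I, D.uy t ≠ 0) (hΩ : D.IsDomain Ω) {Γ u : ℝ × ℝ → ℝ}
    (h : D.RiccatiIVP Ω Γ) (hu : D.Quadrature Ω Γ u) :
    ContDiffOn ℝ ∞ Γ Ω ∧ ContDiffOn ℝ ∞ u Ω := by
  suffices H : ∀ p ∈ Ω, ContDiffAt ℝ ∞ Γ p ∧ ContDiffAt ℝ ∞ u p from
    ⟨fun p hp => (H p hp).1.contDiffWithinAt, fun p hp => (H p hp).2.contDiffWithinAt⟩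
  rintro ⟨x, y₁⟩ hp
  obtain ⟨t, ht, rfl : (D.γ t).1 = x⟩ := hΩ.fst_mem _ hp
  obtain ⟨a, b, hyab, hab, G, w, sG, sw, hGw⟩ := D.exists_local_model huy
    (isOpen_vertical hΩ.isOpen (D.γ t).1) (hΩ.vertical _) (hΩ.vertical_subset_yRange _)
    (Γ₀ := fun s => Γ ((D.γ t).1, s)) (u₀ := fun s => u ((D.γ t).1, s))
    (fun s hs => h.ode (_, s) hs) (fun s hs => hu.ode (_, s) hs) ht (hΩ.curve_mem t ht)
    (h.initial t ht) hp
  -- Tube lemma: `Γ` and `G` must both be defined on the vertical segment from the curve to height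
  -- `y`, for all nearby `x`.
  have htube : ∀ᶠ x in 𝓝 (D.γ t).1, ∀ y ∈ Icc a b, (x, y) ∈ Ω :=
    isCompact_Icc.eventually_forall_of_forall_eventually fun y hy =>
      hΩ.isOpen.mem_nhds (hab hy)
  have heq : ∀ᶠ q in 𝓝 ((D.γ t).1, y₁), Γ q = G q ∧ u q = w q := by
    rw [nhds_prod_eq]
    filter_upwards [(hGw.and htube).prod_mk (isOpen_Ioo.mem_nhds hyab)]
    rintro ⟨x, y⟩ ⟨⟨⟨hxr, hh, hG0, hw0, hode⟩, hsub⟩, hy⟩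
    simp only at hxr hh hG0 hw0 hode hsub hy
    have hsub' : ∀ s ∈ Ioo a b, (x, s) ∈ Ω := fun s hs => hsub s (Ioo_subset_Icc_self hs)
    have hγ := γ_paramAtFst hxr
    have hpm := D.paramAtFst_mem hxr
    have hΓG : ∀ s ∈ Ioo a b, Γ (x, s) = G (x, s) := fun s hs =>
      riccati_unique isOpen_Ioo ordConnected_Ioo (p := D.k₁) (q := D.k₂)
        (g₁ := fun s => Γ (x, s)) (g₂ := fun s => G (x, s))
        ((D.smooth_k₂ huy).continuousOn.mono fun s hs => hΩ.snd_mem_yRange (hsub' s hs))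
        (fun s hs => h.ode (x, s) (hsub' s hs)) (fun s hs => (hode s hs).1) hh
        (by rw [hG0, ← h.initial _ hpm, hγ]) hs
    refine ⟨hΓG y hy, quadrature_unique isOpen_Ioo ordConnected_Ioo
      (g := fun s => G (x, s)) (u₁ := fun s => u (x, s)) (u₂ := fun s => w (x, s))
      (fun s hs => hΓG s hs ▸ hu.ode (x, s) (hsub' s hs)) (fun s hs => (hode s hs).2) hh
      (by rw [hw0, ← hu.initial _ hpm, hγ]) hy⟩
  exact ⟨sG.congr_of_eventuallyEq (heq.mono fun _ h => h.1),
    sw.congr_of_eventuallyEq (heq.mono fun _ h => h.2)⟩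

end CauchyData

/-! ### Algebraic recovery of `v` -/

theorem add_div_eq_zero_iff {p q c : ℝ} (hc : c ≠ 0) : q + p / c = 0 ↔ q * c + p = 0 := by
  rw [add_div' _ _ _ hc, div_eq_zero_iff, or_iff_left hc]

theorem exp_half_eq {a b p q : ℝ} (hq : q ≠ 0)
    (h : q + p / (2 * (1 + Real.exp (a / 2 + b / 2))) = 0) :
    Real.exp (b / 2) = -Real.exp (-(a / 2)) * (1 + p / (2 * q)) := by
  have hpos : (2 * (1 + Real.exp (a / 2 + b / 2))) ≠ 0 := by positivity
  have hp : p = -(q * (2 * (1 + Real.exp (a / 2 + b / 2)))) := by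
    rw [add_div_eq_zero_iff hpos] at h
    linarith
  have h2 : 1 + p / (2 * q) = -Real.exp (a / 2 + b / 2) := by
    rw [hp]
    field_simp
    ring
  rw [h2, Real.exp_add, neg_mul_neg, ← mul_assoc, ← Real.exp_add]
  simp

theorem recovery_of_exp_half_eq {a b p q : ℝ} (hq : q ≠ 0)
    (h : Real.exp (b / 2) = -Real.exp (-(a / 2)) * (1 + p / (2 * q))) :
    q + p / (2 * (1 + Real.exp (a / 2 + b / 2))) = 0 := by
  have h2 : Real.exp (a / 2 + b / 2) = -(1 + p / (2 * q)) := by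
    rw [Real.exp_add, h, neg_mul, mul_neg, ← mul_assoc, ← Real.exp_add]
    simp
  have hpos : 0 < Real.exp (a / 2 + b / 2) := Real.exp_pos _
  have h3 : p = -(2 * q * (1 + Real.exp (a / 2 + b / 2))) := by
    rw [h2]
    field_simp
    ring
  rw [h3]
  field_simp
  ring

/-- The function `v` for which the first equation holds, when `u` is given. -/
def recoveredV (u : ℝ × ℝ → ℝ) (p : ℝ × ℝ) : ℝ :=
  2 * Real.log (-Real.exp (-(u p / 2)) * (1 + dx u p * dy u p / (2 * dx (dy u) p)))

namespace CauchyData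

variable {D : CauchyData} {Ω : Set (ℝ × ℝ)}

/-! ### Nonvanishing of `u_xy` and smoothness of the recovered `v` -/

section Reduction

variable (hux : ∀ t ∈ D.I, D.ux t ≠ 0) (huy : ∀ t ∈ D.I, D.uy t ≠ 0) (hΩ : D.IsDomain Ω)
  {Γ u : ℝ × ℝ → ℝ} (h : D.RiccatiIVP Ω Γ) (hu : D.Quadrature Ω Γ u)

theorem Quadrature.dy_eq (hu : D.Quadrature Ω Γ u) : EqOn (dy u) Γ Ω :=
  fun p hp => (hu.ode p hp).deriv

include hΩ h in
-- The coefficients depend on `y` alone, so differentiating the Riccati equation in `x` gives its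
-- linearization, with no source term.
theorem dx_Γ_ode {p : ℝ × ℝ} (hp : p ∈ Ω) (sΓ : ContDiffOn ℝ ∞ Γ Ω) :
    dy (dx Γ) p = (1 / 2) * (D.k₂ p.2 - 2 * Γ p) * dx Γ p := by
  have hode : EqOn (dy Γ) (fun q => (1 / 2) * (D.k₁ q.2 + D.k₂ q.2 * Γ q - Γ q ^ 2)) Ω :=
    fun q hq => (h.ode q hq).deriv
  rw [← dx_dy_comm hΩ.isOpen sΓ hp, dx_congr hΩ.isOpen hode hp]
  have d := hasDerivAt_dx hΩ.isOpen sΓ hp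
  refine (HasDerivAt.congr_deriv (((((d.const_mul (D.k₂ p.2)).const_add (D.k₁ p.2)).sub
    (d.pow 2))).const_mul (1 / 2 : ℝ)) ?_).deriv
  simp
  ring

include huy hΩ h hu in
-- The derivative of `Γ` along the curve is known, and the Riccati equation gives `Γ_y` there as the
-- prescribed `u_yy`; the chain rule leaves the prescribed `u_xy` for `Γ_x`.
theorem jets_of_riccati {t : ℝ} (ht : t ∈ D.I) :
    dx u (D.γ t) = D.ux t ∧ dy u (D.γ t) = D.uy t ∧ dx Γ (D.γ t) = D.uxy t ∧
      fderiv ℝ u (D.γ t) (D.n t) = D.ψ₁ t := by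
  obtain ⟨sΓ, su⟩ := smooth_of_riccati huy hΩ h hu
  have hmem := hΩ.curve_mem t ht
  have h1 : dy u (D.γ t) = D.uy t := (hu.dy_eq hmem).trans (h.initial t ht)
  obtain ⟨h2, h3⟩ := normal_of_dy hΩ su hu.initial (ψ := D.ψ₁) ht h1
  refine ⟨h2, h1, ?_, h3⟩
  have h4 := deriv_along hΩ sΓ h.initial ht
  have h5 : dy Γ (D.γ t) = D.uyy t := by
    rw [D.uyy_eq huy ht, ← h.initial t ht]
    exact (h.ode _ hmem).deriv
  have h6 : D.uyy t * (deriv D.γ t).2 = deriv D.uy t - D.uxy t * (deriv D.γ t).1 :=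
    div_mul_cancel₀ _ (D.tangent_snd t ht)
  rw [h5, h6] at h4
  exact mul_right_cancel₀ (D.tangent_fst t ht) (by linarith)

include hux huy hΩ h hu in
theorem dx_Γ_ne_zero {p : ℝ × ℝ} (hp : p ∈ Ω) : dx Γ p ≠ 0 := by
  obtain ⟨sΓ, su⟩ := smooth_of_riccati huy hΩ h hu
  obtain ⟨x, y⟩ := p
  obtain ⟨t, ht, hγ, hmem⟩ := hΩ.exists_vertical hp
  have hc : ContinuousOn (fun s => Γ (x, s)) {y : ℝ | (x, y) ∈ Ω} :=
    sΓ.continuousOn.comp (by fun_prop) fun _ hs => hs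
  refine linear_ode_ne_zero (isOpen_vertical hΩ.isOpen x) (hΩ.vertical x)
    (A := fun s => (1 / 2) * (D.k₂ s - 2 * Γ (x, s))) (g := fun s => dx Γ (x, s))
    (continuousOn_const.mul (((D.smooth_k₂ huy).continuousOn.mono
      (hΩ.vertical_subset_yRange x)).sub (continuousOn_const.mul hc)))
    (fun s hs => ?_) hmem ?_ hp
  · have := hasDerivAt_dy hΩ.isOpen (contDiffOn_dx hΩ.isOpen sΓ) hs
    rwa [dx_Γ_ode hΩ h hs sΓ] at this
  · dsimp only at hγ ⊢
    rw [← hγ, (jets_of_riccati huy hΩ h hu ht).2.2.1]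
    exact D.uxy_ne_zero hux huy ht

include hux huy hΩ h hu in
theorem dx_dy_u_ne_zero {p : ℝ × ℝ} (hp : p ∈ Ω) : dx (dy u) p ≠ 0 := by
  rw [dx_congr hΩ.isOpen hu.dy_eq hp]
  exact dx_Γ_ne_zero hux huy hΩ h hu hp

include hux huy hΩ h hu in
theorem contDiffOn_recovery_argument :
    ContDiffOn ℝ ∞ (fun p => -Real.exp (-(u p / 2)) *
      (1 + dx u p * dy u p / (2 * dx (dy u) p))) Ω := by
  obtain ⟨sΓ, su⟩ := smooth_of_riccati huy hΩ h hu
  have hy := contDiffOn_dy hΩ.isOpen su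
  exact (su.div_const 2).neg.exp.neg.mul (contDiffOn_const.add
    (((contDiffOn_dx hΩ.isOpen su).mul hy).div
      (contDiffOn_const.mul (contDiffOn_dx hΩ.isOpen hy))
      fun p hp => mul_ne_zero two_ne_zero (dx_dy_u_ne_zero hux huy hΩ h hu hp)))

end Reduction

theorem IsRiccatiReduction.exp_half_v (hux : ∀ t ∈ D.I, D.ux t ≠ 0)
    (huy : ∀ t ∈ D.I, D.uy t ≠ 0) (hΩ : D.IsDomain Ω) {Γ u v : ℝ × ℝ → ℝ}
    (R : D.IsRiccatiReduction Ω Γ u v) {p : ℝ × ℝ} (hp : p ∈ Ω) :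
    Real.exp (v p / 2) = -Real.exp (-(u p / 2)) *
      (1 + dx u p * dy u p / (2 * dx (dy u) p)) :=
  exp_half_eq (dx_dy_u_ne_zero hux huy hΩ R.riccati R.quadrature hp) (R.recovery p hp)

theorem IsRiccatiReduction.v_eq (hux : ∀ t ∈ D.I, D.ux t ≠ 0)
    (huy : ∀ t ∈ D.I, D.uy t ≠ 0) (hΩ : D.IsDomain Ω) {Γ u v : ℝ × ℝ → ℝ}
    (R : D.IsRiccatiReduction Ω Γ u v) : EqOn v (recoveredV u) Ω := fun p hp => by
  rw [recoveredV, ← R.exp_half_v hux huy hΩ hp, Real.log_exp]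
  ring

theorem IsRiccatiReduction.smooth_v (hux : ∀ t ∈ D.I, D.ux t ≠ 0)
    (huy : ∀ t ∈ D.I, D.uy t ≠ 0) (hΩ : D.IsDomain Ω) {Γ u v : ℝ × ℝ → ℝ}
    (R : D.IsRiccatiReduction Ω Γ u v) : ContDiffOn ℝ ∞ v Ω := by
  refine ContDiffOn.congr ?_ (R.v_eq hux huy hΩ)
  refine contDiffOn_const.mul
    ((contDiffOn_recovery_argument hux huy hΩ R.riccati R.quadrature).log fun p hp => ?_)
  rw [← R.exp_half_v hux huy hΩ hp]
  exact Real.exp_ne_zero _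

/-! ### From the reduction to the second equation and the data for `v` -/

theorem hasDerivAt_exp_dx (hΩ : IsOpen Ω) {u v : ℝ × ℝ → ℝ} (su : ContDiffOn ℝ ∞ u Ω)
    (sv : ContDiffOn ℝ ∞ v Ω) {p : ℝ × ℝ} (hp : p ∈ Ω) :
    HasDerivAt (fun s => Real.exp (u (s, p.2) / 2 + v (s, p.2) / 2))
      (Real.exp (u p / 2 + v p / 2) * (dx u p / 2 + dx v p / 2)) p.1 :=
  (((hasDerivAt_dx hΩ su hp).div_const 2).add ((hasDerivAt_dx hΩ sv hp).div_const 2)).exp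

theorem hasDerivAt_exp_dy (hΩ : IsOpen Ω) {u v : ℝ × ℝ → ℝ} (su : ContDiffOn ℝ ∞ u Ω)
    (sv : ContDiffOn ℝ ∞ v Ω) {p : ℝ × ℝ} (hp : p ∈ Ω) :
    HasDerivAt (fun s => Real.exp (u (p.1, s) / 2 + v (p.1, s) / 2))
      (Real.exp (u p / 2 + v p / 2) * (dy u p / 2 + dy v p / 2)) p.2 :=
  (((hasDerivAt_dy hΩ su hp).div_const 2).add ((hasDerivAt_dy hΩ sv hp).div_const 2)).exp

/-- The first equation without denominators. -/
theorem firstPDE_mul {u v : ℝ × ℝ → ℝ} {p : ℝ × ℝ}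
    (h : dx (dy u) p + dx u p * dy u p / (2 * (1 + Real.exp (u p / 2 + v p / 2))) = 0) :
    2 * dx (dy u) p * (1 + Real.exp (u p / 2 + v p / 2)) + dx u p * dy u p = 0 := by
  have hpos : (2 * (1 + Real.exp (u p / 2 + v p / 2))) ≠ 0 := by positivity
  rw [add_div_eq_zero_iff hpos] at h
  linarith

/-- The `y`-derivative of the first equation. -/
theorem firstPDE_dy (hΩ : IsOpen Ω) {u v : ℝ × ℝ → ℝ} (su : ContDiffOn ℝ ∞ u Ω)
    (sv : ContDiffOn ℝ ∞ v Ω) (h : FirstPDE Ω u v) {p : ℝ × ℝ} (hp : p ∈ Ω) :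
    2 * dy (dx (dy u)) p * (1 + Real.exp (u p / 2 + v p / 2))
      + dx (dy u) p * Real.exp (u p / 2 + v p / 2) * (dy u p + dy v p)
      + dx (dy u) p * dy u p + dx u p * dy (dy u) p = 0 := by
  have sy := contDiffOn_dy hΩ su
  have d1 := hasDerivAt_dy hΩ (contDiffOn_dx hΩ sy) hp
  have d2 := hasDerivAt_dy hΩ (contDiffOn_dx hΩ su) hp
  have d3 := hasDerivAt_dy hΩ sy hp
  have d := ((d1.const_mul 2).mul ((hasDerivAt_exp_dy hΩ su sv hp).const_add 1)).add (d2.mul d3)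
  have hz : (fun s => (2 * dx (dy u) (p.1, s) *
      (1 + Real.exp (u (p.1, s) / 2 + v (p.1, s) / 2)) + dx u (p.1, s) * dy u (p.1, s)))
      =ᶠ[𝓝 p.2] fun _ => 0 :=
    Filter.mem_of_superset ((isOpen_vertical hΩ p.1).mem_nhds hp) fun s hs =>
      firstPDE_mul (h (p.1, s) hs)
  have := d.unique ((hasDerivAt_const p.2 (0 : ℝ)).congr_of_eventuallyEq hz)
  rw [← dx_dy_comm hΩ su hp] at this
  linarith

/-- The first integral `β₁` has the prescribed values. -/
theorem IsRiccatiReduction.first_integral (hux : ∀ t ∈ D.I, D.ux t ≠ 0)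
    (huy : ∀ t ∈ D.I, D.uy t ≠ 0) (hΩ : D.IsDomain Ω) {Γ u v : ℝ × ℝ → ℝ}
    (R : D.IsRiccatiReduction Ω Γ u v) {p : ℝ × ℝ} (hp : p ∈ Ω) :
    dy u p * dy v p * Real.exp (u p / 2 + v p / 2)
      = D.k₁ p.2 * (1 + Real.exp (u p / 2 + v p / 2)) := by
  obtain ⟨sΓ, su⟩ := smooth_of_riccati huy hΩ R.riccati R.quadrature
  have sv := R.smooth_v hux huy hΩ
  have hne := dx_dy_u_ne_zero hux huy hΩ R.riccati R.quadrature hp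
  have e1 := firstPDE_dy hΩ.isOpen su sv R.recovery hp
  have e2 := firstPDE_mul (R.recovery p hp)
  have hxΓ : EqOn (dx (dy u)) (dx Γ) Ω := fun q hq => dx_congr hΩ.isOpen R.quadrature.dy_eq hq
  have e3 : dy (dx (dy u)) p = (1 / 2) * (D.k₂ p.2 - 2 * dy u p) * dx (dy u) p := by
    rw [dy_congr hΩ.isOpen hxΓ hp, dx_Γ_ode hΩ R.riccati hp sΓ, hxΓ hp,
      R.quadrature.dy_eq hp]
  have e4 : dy (dy u) p = (1 / 2) * (D.k₁ p.2 + D.k₂ p.2 * dy u p - dy u p ^ 2) := by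
    rw [dy_congr hΩ.isOpen R.quadrature.dy_eq hp, R.quadrature.dy_eq hp]
    exact (R.riccati.ode p hp).deriv
  rw [e3, e4] at e1
  apply mul_left_cancel₀ hne
  -- Subtracting `u_yy` times the first equation removes the term in `u_x`; what remains is `u_xy`
  -- times the claimed identity, because the terms in `k₂` cancel.
  linear_combination dy u p * e1
    - (1 / 2) * (D.k₁ p.2 + D.k₂ p.2 * dy u p - dy u p ^ 2) * e2

theorem IsRiccatiReduction.dy_u_ne_zero (hux : ∀ t ∈ D.I, D.ux t ≠ 0)
    (huy : ∀ t ∈ D.I, D.uy t ≠ 0) (hΩ : D.IsDomain Ω) {Γ u v : ℝ × ℝ → ℝ}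
    (R : D.IsRiccatiReduction Ω Γ u v) {p : ℝ × ℝ} (hp : p ∈ Ω) : dy u p ≠ 0 := fun h0 => by
  have := R.recovery p hp
  rw [h0, mul_zero, zero_div, add_zero] at this
  exact dx_dy_u_ne_zero hux huy hΩ R.riccati R.quadrature hp this

/-- The `x`-derivative of `β₁ = k₁(y)`, cleared of denominators and reduced by the first equation,
is the second equation multiplied by `u_y S`, and both factors are nonzero. -/
theorem IsRiccatiReduction.secondPDE (hux : ∀ t ∈ D.I, D.ux t ≠ 0)
    (huy : ∀ t ∈ D.I, D.uy t ≠ 0) (hΩ : D.IsDomain Ω) {Γ u v : ℝ × ℝ → ℝ}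
    (R : D.IsRiccatiReduction Ω Γ u v) : SecondPDE Ω u v := fun p hp => by
  obtain ⟨-, su⟩ := smooth_of_riccati huy hΩ R.riccati R.quadrature
  have sv := R.smooth_v hux huy hΩ
  have d1 := hasDerivAt_dx hΩ.isOpen (contDiffOn_dy hΩ.isOpen su) hp
  have d2 := hasDerivAt_dx hΩ.isOpen (contDiffOn_dy hΩ.isOpen sv) hp
  have d3 := hasDerivAt_exp_dx hΩ.isOpen su sv hp
  have d := ((d1.mul d2).mul d3).sub ((d3.const_add 1).const_mul (D.k₁ p.2))
  have hz : (fun s => dy u (s, p.2) * dy v (s, p.2)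
      * Real.exp (u (s, p.2) / 2 + v (s, p.2) / 2)
      - D.k₁ p.2 * (1 + Real.exp (u (s, p.2) / 2 + v (s, p.2) / 2))) =ᶠ[𝓝 p.1] fun _ => 0 :=
    Filter.mem_of_superset ((isOpen_horizontal hΩ.isOpen p.2).mem_nhds hp) fun s hs =>
      sub_eq_zero.2 (R.first_integral hux huy hΩ (p := (s, p.2)) hs)
  have e1 := d.unique ((hasDerivAt_const p.1 (0 : ℝ)).congr_of_eventuallyEq hz)
  have e2 := firstPDE_mul (R.recovery p hp)
  have e3 := R.first_integral hux huy hΩ hp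
  have hy := R.dy_u_ne_zero hux huy hΩ hp
  have hS := Real.exp_ne_zero (u p / 2 + v p / 2)
  have hpos : (2 * (1 + Real.exp (u p / 2 + v p / 2))) ≠ 0 := by positivity
  simp only [Prod.mk.eta, Pi.mul_apply] at e1
  generalize Real.exp (u p / 2 + v p / 2) = S at *
  have : 2 * (1 + S) * dx (dy v) p + dx v p * dy v p = 0 := by
    apply mul_left_cancel₀ (mul_ne_zero hy hS)
    linear_combination 2 * (1 + S) * e1 - dy v p * S * e2
      - S * (dx u p + dx v p) * e3
  rw [add_div_eq_zero_iff hpos]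
  linarith

/-- On `γ` the prescribed jets satisfy the first equation with `φ₂` in place of `v`, by the
definition of `uxy`. Since `uxy ≠ 0`, the recovery formula gives the same exponential for both. -/
theorem IsRiccatiReduction.value_v (hux : ∀ t ∈ D.I, D.ux t ≠ 0)
    (huy : ∀ t ∈ D.I, D.uy t ≠ 0) (hΩ : D.IsDomain Ω) {Γ u v : ℝ × ℝ → ℝ}
    (R : D.IsRiccatiReduction Ω Γ u v) {t : ℝ} (ht : t ∈ D.I) : v (D.γ t) = D.φ₂ t := by
  have hmem := hΩ.curve_mem t ht
  obtain ⟨h1, h2, h3, -⟩ := jets_of_riccati huy hΩ R.riccati R.quadrature ht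
  have h4 := R.exp_half_v hux huy hΩ hmem
  rw [h1, h2, dx_congr hΩ.isOpen R.quadrature.dy_eq hmem, h3, R.quadrature.initial t ht,
    ← exp_half_eq (b := D.φ₂ t) (D.uxy_ne_zero hux huy ht) (by rw [uxy]; ring),
    Real.exp_eq_exp] at h4
  linarith

theorem IsRiccatiReduction.isCauchySolution (hux : ∀ t ∈ D.I, D.ux t ≠ 0)
    (huy : ∀ t ∈ D.I, D.uy t ≠ 0) (hΩ : D.IsDomain Ω) {Γ u v : ℝ × ℝ → ℝ}
    (R : D.IsRiccatiReduction Ω Γ u v) : D.IsCauchySolution Ω u v where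
  smooth_u := (smooth_of_riccati huy hΩ R.riccati R.quadrature).2
  smooth_v := R.smooth_v hux huy hΩ
  pde_u := R.recovery
  pde_v := R.secondPDE hux huy hΩ
  value_u := R.quadrature.initial
  value_v := fun t ht => R.value_v hux huy hΩ ht
  normal_u := fun t ht => (jets_of_riccati huy hΩ R.riccati R.quadrature ht).2.2.2
  normal_v := fun t ht => by
    have hv := fun t ht => R.value_v hux huy hΩ (t := t) ht
    refine (normal_of_dy hΩ (R.smooth_v hux huy hΩ) hv ht ?_).2
    have hmem := hΩ.curve_mem t ht
    -- Comparing `β₁ = k₁` on the curve with the definition of `k₁`, and cancelling `u_y ≠ 0`,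
    -- yields the prescribed `v_y`.
    have h1 := R.first_integral hux huy hΩ hmem
    rw [D.k₁_snd ht, b₁, beta₁, (jets_of_riccati huy hΩ R.riccati R.quadrature ht).2.1,
      R.quadrature.initial t ht, hv t ht,
      show -((D.φ₁ t + D.φ₂ t) / 2) = -(D.φ₁ t / 2 + D.φ₂ t / 2) by ring, Real.exp_neg] at h1
    have h2 := huy t ht
    have hS := Real.exp_pos (D.φ₁ t / 2 + D.φ₂ t / 2)
    generalize Real.exp (D.φ₁ t / 2 + D.φ₂ t / 2) = S at *
    have h3 : D.uy t * D.vy t / (1 + S⁻¹) * (1 + S) = D.uy t * D.vy t * S := by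
      field_simp
      ring
    rw [h3] at h1
    exact mul_left_cancel₀ h2 (mul_right_cancel₀ hS.ne' h1)

end CauchyData

namespace CauchyData

variable {D : CauchyData} {Ω : Set (ℝ × ℝ)}

/-! ### Solutions of the Cauchy problem satisfy the Riccati equation -/

section Converse

variable {u v : ℝ × ℝ → ℝ}

theorem exp_neg_half_add (a b : ℝ) :
    Real.exp (-((a + b) / 2)) = (Real.exp (a / 2 + b / 2))⁻¹ := by
  rw [← Real.exp_neg]
  ring_nf

theorem beta₁_eq (a b p q : ℝ) :
    beta₁ a b p q = p * q * Real.exp (a / 2 + b / 2) / (1 + Real.exp (a / 2 + b / 2)) := by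
  rw [beta₁, exp_neg_half_add]
  have := Real.exp_pos (a / 2 + b / 2)
  field_simp
  ring

/-- Along a horizontal line the first equation is homogeneous linear in `u_y`, and the line meets
`γ`, where `u_y` is nonzero. -/
theorem IsCauchySolution.dy_u_ne_zero (huy : ∀ t ∈ D.I, D.uy t ≠ 0) (hΩ : D.IsDomain Ω)
    (C : D.IsCauchySolution Ω u v) {p : ℝ × ℝ} (hp : p ∈ Ω) : dy u p ≠ 0 := by
  obtain ⟨x, y⟩ := p
  obtain ⟨t, ht, hγ, hmem⟩ := hΩ.exists_horizontal hp
  have hline : ∀ {f : ℝ × ℝ → ℝ}, ContDiffOn ℝ ∞ f Ω →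
      ContinuousOn (fun s => f (s, y)) {x : ℝ | (x, y) ∈ Ω} := fun hf =>
    hf.continuousOn.comp (by fun_prop) fun _ hs => hs
  refine linear_ode_ne_zero (isOpen_horizontal hΩ.isOpen y) (hΩ.horizontal y)
    (A := fun s => -(dx u (s, y) / (2 * (1 + Real.exp (u (s, y) / 2 + v (s, y) / 2)))))
    (g := fun s => dy u (s, y)) ?_ (fun s hs => ?_) hmem ?_ hp
  · exact ((hline (contDiffOn_dx hΩ.isOpen C.smooth_u)).div (continuousOn_const.mul
      (continuousOn_const.add (((hline C.smooth_u).div_const 2).add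
        ((hline C.smooth_v).div_const 2)).rexp)) fun s _ =>
          (by positivity : 2 * (1 + Real.exp (u (s, y) / 2 + v (s, y) / 2)) ≠ 0)).neg
  · refine (hasDerivAt_dx hΩ.isOpen (contDiffOn_dy hΩ.isOpen C.smooth_u) hs).congr_deriv ?_
    rw [eq_neg_of_add_eq_zero_left (C.pde_u (s, y) hs)]
    ring
  · dsimp only at hγ ⊢
    rw [← hγ, (jet_eq hΩ C.smooth_u C.value_u C.normal_u ht).2]
    exact huy t ht

/-- The `x`-derivative of `β₁` is a combination of the two equations, so `β₁` keeps along each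
horizontal line its value on `γ`. -/
theorem IsCauchySolution.first_integral (hΩ : D.IsDomain Ω)
    (C : D.IsCauchySolution Ω u v) {p : ℝ × ℝ} (hp : p ∈ Ω) :
    dy u p * dy v p * Real.exp (u p / 2 + v p / 2)
      = D.k₁ p.2 * (1 + Real.exp (u p / 2 + v p / 2)) := by
  obtain ⟨x, y⟩ := p
  obtain ⟨t, ht, hγ, hmem⟩ := hΩ.exists_horizontal hp
  have hpos : ∀ a : ℝ, 1 + Real.exp a ≠ 0 := fun a => by positivity
  have key := eq_of_hasDerivAt_zero (isOpen_horizontal hΩ.isOpen y) (hΩ.horizontal y)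
    (h := fun s => dy u (s, y) * dy v (s, y) * Real.exp (u (s, y) / 2 + v (s, y) / 2) /
      (1 + Real.exp (u (s, y) / 2 + v (s, y) / 2))) (fun s hs => ?_) hp hmem
  · have hk := D.k₁_snd ht
    rw [b₁, beta₁_eq] at hk
    simp only [← hγ] at key
    rw [(jet_eq hΩ C.smooth_u C.value_u C.normal_u ht).2,
      (jet_eq hΩ C.smooth_v C.value_v C.normal_v ht).2, C.value_u t ht, C.value_v t ht] at key
    have h2 : (D.γ t).2 = y := by rw [hγ]
    rw [h2] at hk
    rw [div_eq_iff (hpos _)] at key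
    rw [key, hk]
    rfl
  · have d1 := hasDerivAt_dx hΩ.isOpen (contDiffOn_dy hΩ.isOpen C.smooth_u) hs
    have d2 := hasDerivAt_dx hΩ.isOpen (contDiffOn_dy hΩ.isOpen C.smooth_v) hs
    have d3 := hasDerivAt_exp_dx hΩ.isOpen C.smooth_u C.smooth_v hs
    have e1 := firstPDE_mul (C.pde_u (s, y) hs)
    have e2 := C.pde_v (s, y) hs
    rw [add_div_eq_zero_iff (mul_ne_zero two_ne_zero (hpos _))] at e2
    refine (((d1.mul d2).mul d3).div (d3.const_add 1) (hpos _)).congr_deriv ?_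
    simp only [Pi.mul_apply]
    rw [div_eq_zero_iff]
    left
    generalize Real.exp (u (s, y) / 2 + v (s, y) / 2) = S at *
    linear_combination (1 / 2) * S * dy v (s, y) * e1 + (1 / 2) * S * dy u (s, y) * e2

/-- This is conservation of `β₃` along horizontal lines. Because `β₁` is already known to be `k₁`,
it can be held constant when differentiating in `x`. -/
theorem IsCauchySolution.second_integral (huy : ∀ t ∈ D.I, D.uy t ≠ 0) (hΩ : D.IsDomain Ω)
    (C : D.IsCauchySolution Ω u v) {p : ℝ × ℝ} (hp : p ∈ Ω) :
    2 * dy (dy u) p + dy u p ^ 2 - D.k₁ p.2 = D.k₂ p.2 * dy u p := by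
  obtain ⟨x, y⟩ := p
  obtain ⟨t, ht, hγ, hmem⟩ := hΩ.exists_horizontal hp
  have sy := contDiffOn_dy hΩ.isOpen C.smooth_u
  have key := eq_of_hasDerivAt_zero (isOpen_horizontal hΩ.isOpen y) (hΩ.horizontal y)
    (h := fun s => (2 * dy (dy u) (s, y) + dy u (s, y) ^ 2 - D.k₁ y) / dy u (s, y))
    (fun s hs => ?_) hp hmem
  · have hu := fun t ht => (jet_eq hΩ C.smooth_u C.value_u C.normal_u (t := t) ht).2
    have hyy : dy (dy u) (D.γ t) = D.uyy t := by
      have h1 := deriv_along hΩ sy hu ht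
      have h2 : dx (dy u) (D.γ t) = D.uxy t := by
        rw [eq_neg_of_add_eq_zero_left (C.pde_u _ (hΩ.curve_mem t ht)), hu t ht,
          (jet_eq hΩ C.smooth_u C.value_u C.normal_u ht).1, C.value_u t ht, C.value_v t ht]
        rfl
      rw [h2] at h1
      rw [uyy, eq_div_iff (D.tangent_snd t ht)]
      change _ = deriv D.uy t at h1
      linarith
    simp only [← hγ] at key
    have h2 : (D.γ t).2 = y := by rw [hγ]
    have huy' := hu t ht
    rw [show D.jetY D.φ₁ D.ψ₁ t = D.uy t from rfl] at huy'
    rw [huy', hyy, D.uyy_eq huy ht, h2, div_eq_iff (C.dy_u_ne_zero huy hΩ hp)] at key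
    rw [key]
    have := huy t ht
    field_simp
    ring
  · have d1 := hasDerivAt_dx hΩ.isOpen (contDiffOn_dy hΩ.isOpen sy) hs
    have d2 := hasDerivAt_dx hΩ.isOpen sy hs
    have hne := C.dy_u_ne_zero huy hΩ hs
    have e0 := C.first_integral hΩ hs
    have e1 := firstPDE_mul (C.pde_u (s, y) hs)
    have e2 := firstPDE_dy hΩ.isOpen C.smooth_u C.smooth_v C.pde_u hs
    refine ((((d1.const_mul 2).add (d2.pow 2)).sub_const (D.k₁ y)).div d2 hne).congr_deriv ?_
    rw [div_eq_zero_iff]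
    left
    rw [dx_dy_comm hΩ.isOpen sy hs]
    have hpos : 1 + Real.exp (u (s, y) / 2 + v (s, y) / 2) ≠ 0 := by positivity
    generalize Real.exp (u (s, y) / 2 + v (s, y) / 2) = S at *
    apply mul_left_cancel₀ hpos
    simp only [Pi.add_apply, Pi.pow_apply]
    push_cast
    -- After multiplication by `1 + S`, the numerator of the derivative of `β₃` is a combination of
    -- the `y`-derivative of the first equation, `β₁ = k₁`, and the first equation itself.
    linear_combination dy u (s, y) * e2 - dx (dy u) (s, y) * e0 - dy (dy u) (s, y) * e1

theorem IsCauchySolution.isRiccatiReduction (huy : ∀ t ∈ D.I, D.uy t ≠ 0) (hΩ : D.IsDomain Ω)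
    (C : D.IsCauchySolution Ω u v) : D.IsRiccatiReduction Ω (dy u) u v where
  riccati :=
    { ode := fun p hp => by
        refine (hasDerivAt_dy hΩ.isOpen (contDiffOn_dy hΩ.isOpen C.smooth_u) hp).congr_deriv ?_
        have := C.second_integral huy hΩ hp
        linarith
      initial := fun t ht => (jet_eq hΩ C.smooth_u C.value_u C.normal_u ht).2 }
  quadrature :=
    { ode := fun p hp => hasDerivAt_dy hΩ.isOpen C.smooth_u hp
      initial := C.value_u }
  recovery := C.pde_u

end Converse

/-! ### Uniqueness for the Cauchy problem -/

theorem IsRiccatiReduction.eqOn_of_isCauchySolution (hux : ∀ t ∈ D.I, D.ux t ≠ 0)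
    (huy : ∀ t ∈ D.I, D.uy t ≠ 0) (hΩ : D.IsDomain Ω) {Γ u v u' v' : ℝ × ℝ → ℝ}
    (R : D.IsRiccatiReduction Ω Γ u v) (C : D.IsCauchySolution Ω u' v') :
    EqOn u' u Ω ∧ EqOn v' v Ω := by
  have R' := C.isRiccatiReduction huy hΩ
  have hu : EqOn u' u Ω := R.quadrature.eqOn hΩ R'.quadrature (R.riccati.eqOn huy hΩ R'.riccati)
  refine ⟨hu, fun p hp => ?_⟩
  have hdy : EqOn (dy u') (dy u) Ω := fun q hq => dy_congr hΩ.isOpen hu hq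
  rw [R.v_eq hux huy hΩ hp, R'.v_eq hux huy hΩ hp, recoveredV, recoveredV, hu hp, hdy hp,
    dx_congr hΩ.isOpen hu hp, dx_congr hΩ.isOpen hdy hp]

end CauchyData

/-! ### Wave maps -/

section WaveMaps

/-- The metric is `l(z₀)` times the flat Lorentzian one, with `l(s) = 1 / (1 + exp (-s))`; every
nonzero symbol is `l' / (2 l)`, and `l' / l = 1 / (1 + exp s)`. -/
theorem christoffel_targetMetric (z : Fin 2 → ℝ) (c a b : Fin 2) :
    christoffel targetMetric z c a b =
      if (c = 0 ↔ a = b) then 1 / (2 * (1 + Real.exp (z 0))) else 0 := by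
  have hpos : (1 + Real.exp (-z 0)) ≠ 0 := by positivity
  have hinv : (targetMetric z)⁻¹ = !![1 + Real.exp (-z 0), 0; 0, -(1 + Real.exp (-z 0))] := by
    apply Matrix.inv_eq_right_inv
    ext i j
    fin_cases i <;> fin_cases j <;> simp [targetMetric, Matrix.mul_apply, hpos, -neg_add_rev]
  have hd : HasFDerivAt (fun w : Fin 2 → ℝ => 1 / (1 + Real.exp (-w 0)))
      ((Real.exp (-z 0) / (1 + Real.exp (-z 0)) ^ 2) •
        (ContinuousLinearMap.proj 0 : (Fin 2 → ℝ) →L[ℝ] ℝ)) z := by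
    have h1 : HasDerivAt (fun s : ℝ => 1 / (1 + Real.exp (-s)))
        (Real.exp (-z 0) / (1 + Real.exp (-z 0)) ^ 2) (z 0) := by
      refine ((hasDerivAt_const (z 0) (1 : ℝ)).div
        (((hasDerivAt_id' (z 0)).neg.exp).const_add 1) hpos).congr_deriv ?_
      simp
    exact HasDerivAt.comp_hasFDerivAt (h₂ := fun s : ℝ => 1 / (1 + Real.exp (-s)))
      (f := fun w : Fin 2 → ℝ => w 0) z h1
      (ContinuousLinearMap.proj 0 : (Fin 2 → ℝ) →L[ℝ] ℝ).hasFDerivAt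
  have h00 : ∀ e, tpd e (fun w => targetMetric w 0 0) z =
      if e = 0 then Real.exp (-z 0) / (1 + Real.exp (-z 0)) ^ 2 else 0 := fun e => by
    have : (fun w : Fin 2 → ℝ => targetMetric w 0 0) = fun w => 1 / (1 + Real.exp (-w 0)) := by
      ext w
      simp [targetMetric]
    rw [tpd, this, hd.fderiv]
    fin_cases e <;> simp
  have h11 : ∀ e, tpd e (fun w => targetMetric w 1 1) z =
      if e = 0 then -(Real.exp (-z 0) / (1 + Real.exp (-z 0)) ^ 2) else 0 := fun e => by
    have : (fun w : Fin 2 → ℝ => targetMetric w 1 1) = fun w => -(1 / (1 + Real.exp (-w 0))) := by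
      ext w
      simp [targetMetric]
    rw [tpd, this, hd.fun_neg.fderiv]
    fin_cases e <;> simp
  have h01 : ∀ e, tpd e (fun w => targetMetric w 0 1) z = 0 := fun e => by
    have : (fun w : Fin 2 → ℝ => targetMetric w 0 1) = fun _ => 0 := by
      ext w
      simp [targetMetric]
    rw [tpd, this]
    simp
  have h10 : ∀ e, tpd e (fun w => targetMetric w 1 0) z = 0 := fun e => by
    have : (fun w : Fin 2 → ℝ => targetMetric w 1 0) = fun _ => 0 := by
      ext w
      simp [targetMetric]
    rw [tpd, this]
    simp
  have hval : Real.exp (-z 0) / (1 + Real.exp (-z 0)) ^ 2 * (1 + Real.exp (-z 0))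
      = 1 / (1 + Real.exp (z 0)) := by
    rw [Real.exp_neg] at hpos ⊢
    have := Real.exp_pos (z 0)
    field_simp
    ring
  have hhalf : 1 / (2 * (1 + Real.exp (z 0))) = (1 / 2) * (1 / (1 + Real.exp (z 0))) := by
    field_simp
  rw [christoffel, hinv, Fin.sum_univ_two, hhalf, ← hval]
  fin_cases c <;> fin_cases a <;> fin_cases b <;> simp [h00, h11, h01, h10] <;> ring

theorem minkowski_inv : minkowski⁻¹ = !![0, 2; 2, 0] := by
  apply Matrix.inv_eq_right_inv
  ext i j
  fin_cases i <;> fin_cases j <;> simp [minkowski, Matrix.mul_apply]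

/-- The wave map equation in null coordinates. -/
theorem waveMap_equation_iff {Ω : Set (ℝ × ℝ)} (hΩ : IsOpen Ω) {U : ℝ × ℝ → Fin 2 → ℝ}
    (hU : ContDiffOn ℝ ∞ U Ω) {p : ℝ × ℝ} (hp : p ∈ Ω) :
    (∀ c : Fin 2, ∑ i, ∑ j, minkowski⁻¹ i j *
      (pd i (pd j (fun q => U q c)) p
        + ∑ a, ∑ b, christoffel targetMetric (U p) c a b
            * pd i (fun q => U q a) p * pd j (fun q => U q b) p) = 0) ↔
      dx (dy fun q => U q 0) p + (dx (fun q => U q 0) p * dy (fun q => U q 0) p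
        + dx (fun q => U q 1) p * dy (fun q => U q 1) p) / (2 * (1 + Real.exp (U p 0))) = 0 ∧
      dx (dy fun q => U q 1) p + (dx (fun q => U q 0) p * dy (fun q => U q 1) p
        + dx (fun q => U q 1) p * dy (fun q => U q 0) p) / (2 * (1 + Real.exp (U p 0))) = 0 := by
  have s : ∀ c, ContDiffOn ℝ ∞ (fun q => U q c) Ω := fun c => contDiffOn_pi.1 hU c
  rw [Fin.forall_fin_two]
  simp only [minkowski_inv, Fin.sum_univ_two, christoffel_targetMetric, pd]
  simp only [Matrix.of_apply, Matrix.cons_val', Matrix.cons_val_zero, Matrix.cons_val_one,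
    Matrix.cons_val_fin_one, Fin.isValue, one_ne_zero, zero_ne_one, if_true, if_false, iff_true,
    iff_false, not_true_eq_false, iff_self]
  rw [dx_dy_comm hΩ (s 0) hp, dx_dy_comm hΩ (s 1) hp]
  refine and_congr ?_ ?_
  all_goals
    constructor
    · intro h
      linear_combination (1 / 4) * h
    · intro h
      linear_combination 4 * h

end WaveMaps

section Linear

variable {Ω : Set (ℝ × ℝ)} (hΩ : IsOpen Ω) {f g : ℝ × ℝ → ℝ} (hf : ContDiffOn ℝ ∞ f Ω)
  (hg : ContDiffOn ℝ ∞ g Ω) (a b : ℝ)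
include hΩ hf hg

theorem dx_linear {p : ℝ × ℝ} (hp : p ∈ Ω) :
    dx (fun q => a * f q + b * g q) p = a * dx f p + b * dx g p :=
  (((hasDerivAt_dx hΩ hf hp).const_mul a).add ((hasDerivAt_dx hΩ hg hp).const_mul b)).deriv

theorem dy_linear {p : ℝ × ℝ} (hp : p ∈ Ω) :
    dy (fun q => a * f q + b * g q) p = a * dy f p + b * dy g p :=
  (((hasDerivAt_dy hΩ hf hp).const_mul a).add ((hasDerivAt_dy hΩ hg hp).const_mul b)).deriv

theorem dx_dy_linear {p : ℝ × ℝ} (hp : p ∈ Ω) :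
    dx (dy fun q => a * f q + b * g q) p = a * dx (dy f) p + b * dx (dy g) p := by
  rw [dx_congr hΩ (fun q hq => dy_linear hΩ hf hg a b hq) hp,
    dx_linear hΩ (contDiffOn_dy hΩ hf) (contDiffOn_dy hΩ hg) a b hp]

theorem fderiv_linear {p : ℝ × ℝ} (hp : p ∈ Ω) (w : ℝ × ℝ) :
    fderiv ℝ (fun q => a * f q + b * g q) p w = a * fderiv ℝ f p w + b * fderiv ℝ g p w := by
  have df := differentiableAt_of_smoothOn hΩ hf hp
  have dg := differentiableAt_of_smoothOn hΩ hg hp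
  rw [((df.hasFDerivAt.const_mul a).fun_add (dg.hasFDerivAt.const_mul b)).fderiv]
  simp

end Linear

namespace CauchyData

variable {D : CauchyData} {Ω : Set (ℝ × ℝ)}

theorem IsCauchySolution.isWaveMapCauchySolution (hΩ : D.IsDomain Ω) {u v : ℝ × ℝ → ℝ}
    (C : D.IsCauchySolution Ω u v) :
    D.IsWaveMapCauchySolution Ω (fun p => ![(u p + v p) / 2, (u p - v p) / 2]) := by
  have su := C.smooth_u
  have sv := C.smooth_v
  have h0 : (fun p => (![(u p + v p) / 2, (u p - v p) / 2] : Fin 2 → ℝ) 0)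
      = fun p => (1 / 2) * u p + (1 / 2) * v p := by
    ext p
    simp only [Matrix.cons_val_zero]
    ring
  have h1 : (fun p => (![(u p + v p) / 2, (u p - v p) / 2] : Fin 2 → ℝ) 1)
      = fun p => (1 / 2) * u p + (-(1 / 2)) * v p := by
    ext p
    simp only [Matrix.cons_val_one, Matrix.cons_val_fin_one]
    ring
  have sU : ContDiffOn ℝ ∞ (fun p => ![(u p + v p) / 2, (u p - v p) / 2]) Ω := by
    rw [contDiffOn_pi, Fin.forall_fin_two, h0, h1]
    exact ⟨(contDiffOn_const.mul su).add (contDiffOn_const.mul sv),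
      (contDiffOn_const.mul su).add (contDiffOn_const.mul sv)⟩
  refine ⟨⟨sU, fun p hp => (waveMap_equation_iff hΩ.isOpen sU hp).2 ?_⟩, fun t ht => ?_,
    fun t ht => ?_, fun t ht => ?_, fun t ht => ?_⟩
  · have e1 := C.pde_u p hp
    have e2 := C.pde_v p hp
    rw [h0, h1]
    simp only [dx_dy_linear hΩ.isOpen su sv _ _ hp, dx_linear hΩ.isOpen su sv _ _ hp,
      dy_linear hΩ.isOpen su sv _ _ hp, Matrix.cons_val_zero, add_div]
    constructor
    · linear_combination (1 / 2) * e1 + (1 / 2) * e2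
    · linear_combination (1 / 2) * e1 - (1 / 2) * e2
  · simp [C.value_u t ht, C.value_v t ht]
  · simp [C.value_u t ht, C.value_v t ht]
  · rw [h0, fderiv_linear hΩ.isOpen su sv _ _ (hΩ.curve_mem t ht), C.normal_u t ht,
      C.normal_v t ht]
    ring
  · rw [h1, fderiv_linear hΩ.isOpen su sv _ _ (hΩ.curve_mem t ht), C.normal_u t ht,
      C.normal_v t ht]
    ring

/-- The quadratic terms of the wave map equations factor after adding and subtracting: they become
`(u₁ ± u₂)_x (u₁ ± u₂)_y`. The exponent agrees because `u/2 + v/2 = u₁`. -/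
theorem IsWaveMapCauchySolution.isCauchySolution (hΩ : D.IsDomain Ω) {U : ℝ × ℝ → Fin 2 → ℝ}
    (W : D.IsWaveMapCauchySolution Ω U) :
    D.IsCauchySolution Ω (fun p => 1 * U p 0 + 1 * U p 1) (fun p => 1 * U p 0 + (-1) * U p 1) := by
  have s : ∀ c, ContDiffOn ℝ ∞ (fun q => U q c) Ω := fun c => contDiffOn_pi.1 W.waveMap.smooth c
  have e := fun p hp => (waveMap_equation_iff hΩ.isOpen W.waveMap.smooth hp).1
    (W.waveMap.equation p hp)
  have hexp : ∀ p, (1 * U p 0 + 1 * U p 1) / 2 + (1 * U p 0 + (-1) * U p 1) / 2 = U p 0 :=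
    fun p => by ring
  refine ⟨(contDiffOn_const.mul (s 0)).add (contDiffOn_const.mul (s 1)),
    (contDiffOn_const.mul (s 0)).add (contDiffOn_const.mul (s 1)), fun p hp => ?_, fun p hp => ?_,
    fun t ht => ?_, fun t ht => ?_, fun t ht => ?_, fun t ht => ?_⟩
  · rw [hexp, dx_dy_linear hΩ.isOpen (s 0) (s 1) _ _ hp, dx_linear hΩ.isOpen (s 0) (s 1) _ _ hp,
      dy_linear hΩ.isOpen (s 0) (s 1) _ _ hp]
    linear_combination (e p hp).1 + (e p hp).2
  · rw [hexp, dx_dy_linear hΩ.isOpen (s 0) (s 1) _ _ hp, dx_linear hΩ.isOpen (s 0) (s 1) _ _ hp,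
      dy_linear hΩ.isOpen (s 0) (s 1) _ _ hp]
    linear_combination (e p hp).1 - (e p hp).2
  · rw [W.value_fst t ht, W.value_snd t ht]
    ring
  · rw [W.value_fst t ht, W.value_snd t ht]
    ring
  · rw [fderiv_linear hΩ.isOpen (s 0) (s 1) _ _ (hΩ.curve_mem t ht), W.normal_fst t ht,
      W.normal_snd t ht]
    ring
  · rw [fderiv_linear hΩ.isOpen (s 0) (s 1) _ _ (hΩ.curve_mem t ht), W.normal_fst t ht,
      W.normal_snd t ht]
    ring

theorem IsRiccatiReduction.eqOn_of_isWaveMapCauchySolution (hux : ∀ t ∈ D.I, D.ux t ≠ 0)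
    (huy : ∀ t ∈ D.I, D.uy t ≠ 0) (hΩ : D.IsDomain Ω) {Γ u v : ℝ × ℝ → ℝ}
    (R : D.IsRiccatiReduction Ω Γ u v) {U : ℝ × ℝ → Fin 2 → ℝ}
    (W : D.IsWaveMapCauchySolution Ω U) :
    EqOn U (fun p => ![(u p + v p) / 2, (u p - v p) / 2]) Ω := fun p hp => by
  obtain ⟨hu, hv⟩ := R.eqOn_of_isCauchySolution hux huy hΩ (W.isCauchySolution hΩ)
  dsimp only
  rw [← hu hp, ← hv hp]
  ext c
  fin_cases c
  · simp only [Fin.zero_eta, Matrix.cons_val_zero]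
    ring
  · simp only [Fin.mk_one, Matrix.cons_val_one, Matrix.cons_val_fin_one]
    ring

/-! ### Neighbourhoods of the curve -/

/-- The product of the projections of the piece of `γ` with parameters in `(r - ε, r + ε)`. -/
def box (D : CauchyData) (r ε : ℝ) : Set (ℝ × ℝ) :=
  ((fun t => (D.γ t).1) '' (D.I ∩ Ioo (r - ε) (r + ε))) ×ˢ
    ((fun t => (D.γ t).2) '' (D.I ∩ Ioo (r - ε) (r + ε)))

theorem isOpen_box (D : CauchyData) (r ε : ℝ) : IsOpen (D.box r ε) :=
  (isOpen_image_of_deriv_ne_zero (D.isOpen_I.inter isOpen_Ioo)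
    (D.smooth_fst.mono inter_subset_left) fun t ht => D.deriv_fst_ne_zero t ht.1).prod
  (isOpen_image_of_deriv_ne_zero (D.isOpen_I.inter isOpen_Ioo)
    (D.smooth_snd.mono inter_subset_left) fun t ht => D.deriv_snd_ne_zero t ht.1)

theorem γ_mem_box (D : CauchyData) {r ε : ℝ} (hr : r ∈ D.I) (hε : 0 < ε) : D.γ r ∈ D.box r ε :=
  have h : r ∈ D.I ∩ Ioo (r - ε) (r + ε) := ⟨hr, by linarith, by linarith⟩
  ⟨⟨r, h, rfl⟩, ⟨r, h, rfl⟩⟩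

theorem exists_box_subset (D : CauchyData) {r : ℝ} (hr : r ∈ D.I) {N M : Set ℝ}
    (hN : N ∈ 𝓝 (D.γ r).1) (hM : M ∈ 𝓝 (D.γ r).2) : ∃ ε > 0, D.box r ε ⊆ N ×ˢ M := by
  have h1 := (D.hasDerivAt_fst hr).continuousAt hN
  have h2 := (D.hasDerivAt_snd hr).continuousAt hM
  obtain ⟨ε, hε, h⟩ := Metric.mem_nhds_iff.1 (inter_mem h1 h2)
  rw [Real.ball_eq_Ioo] at h
  refine ⟨ε, hε, ?_⟩
  rintro ⟨_, _⟩ ⟨⟨t, ht, rfl⟩, ⟨s, hs, rfl⟩⟩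
  exact ⟨(h ht.2).1, (h hs.2).2⟩

theorem ordConnected_of_pairwise_meet {ι : Type*} {J : Set ι} {A : ι → Set ℝ}
    (hA : ∀ i, (A i).OrdConnected)
    (hmeet : ∀ i ∈ J, ∀ j ∈ J, (A i ∩ A j).Nonempty) : {x | ∃ i ∈ J, x ∈ A i}.OrdConnected := by
  refine ⟨?_⟩
  rintro x₁ ⟨i, hi, h₁⟩ x₂ ⟨j, hj, h₂⟩ z hz
  obtain ⟨c, hci, hcj⟩ := hmeet i hi j hj
  rcases le_total z c with h | h
  · exact ⟨i, hi, (hA i).out h₁ hci ⟨hz.1, h⟩⟩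
  · exact ⟨j, hj, (hA j).out hcj h₂ ⟨h, hz.2⟩⟩

/-- A slice of the union is a union of intervals, one for each box that meets the line. All these
boxes contain the single point of `γ` on that line, so the intervals pairwise meet and their union
is an interval. -/
theorem isDomain_iUnion_box (D : CauchyData) {ε : ℝ → ℝ} (hε : ∀ r ∈ D.I, 0 < ε r) :
    D.IsDomain (⋃ r ∈ D.I, D.box r (ε r)) where
  isOpen := isOpen_biUnion fun r _ => D.isOpen_box r (ε r)
  curve_mem := fun t ht => mem_biUnion ht (D.γ_mem_box ht (hε t ht))
  fst_mem := fun p hp => by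
    obtain ⟨r, -, ⟨t, ht, h⟩, -⟩ := mem_iUnion₂.1 hp
    exact ⟨t, ht.1, h⟩
  snd_mem := fun p hp => by
    obtain ⟨r, -, -, ⟨t, ht, h⟩⟩ := mem_iUnion₂.1 hp
    exact ⟨t, ht.1, h⟩
  horizontal := fun y => by
    have := ordConnected_of_pairwise_meet
      (J := {r | r ∈ D.I ∧ y ∈ (fun t => (D.γ t).2) '' (D.I ∩ Ioo (r - ε r) (r + ε r))})
      (A := fun r => (fun t => (D.γ t).1) '' (D.I ∩ Ioo (r - ε r) (r + ε r)))
      (fun r => ordConnected_image_of_continuousOn (D.ordConnected_I.inter ordConnected_Ioo)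
        (D.smooth_fst.continuousOn.mono inter_subset_left)) ?_
    · convert this using 1
      ext x
      simp only [mem_ofPred_eq, mem_iUnion, box, mem_prod, exists_prop]
      exact exists_congr fun r => by tauto
    · rintro r ⟨-, s, hs, hsy⟩ r' ⟨-, s', hs', hsy'⟩
      obtain rfl := D.injOn_snd hs.1 hs'.1 (hsy.trans hsy'.symm)
      exact ⟨_, ⟨s, hs, rfl⟩, ⟨s, hs', rfl⟩⟩
  vertical := fun x => by
    have := ordConnected_of_pairwise_meet
      (J := {r | r ∈ D.I ∧ x ∈ (fun t => (D.γ t).1) '' (D.I ∩ Ioo (r - ε r) (r + ε r))})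
      (A := fun r => (fun t => (D.γ t).2) '' (D.I ∩ Ioo (r - ε r) (r + ε r)))
      (fun r => ordConnected_image_of_continuousOn (D.ordConnected_I.inter ordConnected_Ioo)
        (D.smooth_snd.continuousOn.mono inter_subset_left)) ?_
    · convert this using 1
      ext y
      simp only [mem_ofPred_eq, mem_iUnion, box, mem_prod, exists_prop]
      exact exists_congr fun r => by tauto
    · rintro r ⟨-, s, hs, hsx⟩ r' ⟨-, s', hs', hsx'⟩
      obtain rfl := D.injOn_fst hs.1 hs'.1 (hsx.trans hsx'.symm)
      exact ⟨_, ⟨s, hs, rfl⟩, ⟨s, hs', rfl⟩⟩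

theorem exists_isDomain_subset (D : CauchyData) {W : Set (ℝ × ℝ)} (hW : IsOpen W)
    (h : ∀ t ∈ D.I, D.γ t ∈ W) : ∃ Ω ⊆ W, D.IsDomain Ω := by
  have : ∀ r ∈ D.I, ∃ ε > 0, D.box r ε ⊆ W := fun r hr => by
    obtain ⟨N, hN, M, hM, hNM⟩ := mem_nhds_prod_iff.1 (hW.mem_nhds (h r hr))
    obtain ⟨ε, hε, hsub⟩ := D.exists_box_subset hr hN hM
    exact ⟨ε, hε, hsub.trans hNM⟩
  choose! ε hε hsub using this
  exact ⟨_, iUnion₂_subset hsub, D.isDomain_iUnion_box hε⟩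

/-! ### Existence -/

theorem exists_local_solution (D : CauchyData) (huy : ∀ t ∈ D.I, D.uy t ≠ 0) {r : ℝ}
    (hr : r ∈ D.I) :
    ∃ ε > 0, ∃ a b : ℝ, ∃ G w : ℝ × ℝ → ℝ, Ioo a b ⊆ D.yRange ∧
      ∀ p ∈ D.box r ε, p.2 ∈ Ioo a b ∧ p.1 ∈ D.xRange ∧ D.height p.1 ∈ Ioo a b ∧
        G (p.1, D.height p.1) = D.uy (D.paramAtFst p.1) ∧
        w (p.1, D.height p.1) = D.φ₁ (D.paramAtFst p.1) ∧
        ∀ y ∈ Ioo a b,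
          HasDerivAt (fun s => G (p.1, s))
            ((1 / 2) * (D.k₁ y + D.k₂ y * G (p.1, y) - G (p.1, y) ^ 2)) y ∧
          HasDerivAt (fun s => w (p.1, s)) (G (p.1, y)) y := by
  have hy : D.yRange ∈ 𝓝 (D.γ r).2 := D.isOpen_yRange.mem_nhds ⟨r, hr, rfl⟩
  obtain ⟨Γ₀, hΓr, δ, hδ, hΓ₀⟩ := riccati_exists_local (D.smooth_k₁.contDiffAt hy)
    ((D.smooth_k₂ huy).contDiffAt hy) (D.uy r)
  set V := Ioo ((D.γ r).2 - δ) ((D.γ r).2 + δ) ∩ D.yRange with hVdef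
  have hV : IsOpen V := isOpen_Ioo.inter D.isOpen_yRange
  have hc : V.OrdConnected := ordConnected_Ioo.inter
    (ordConnected_image_of_continuousOn D.ordConnected_I D.smooth_snd.continuousOn)
  have hrV : (D.γ r).2 ∈ V := ⟨⟨by linarith, by linarith⟩, ⟨r, hr, rfl⟩⟩
  have hΓV := fun y (hy : y ∈ V) => hΓ₀ y hy.1
  obtain ⟨u₀, -, hu₀⟩ := exists_antideriv hV hc
    (fun y hy => (hΓV y hy).continuousAt.continuousWithinAt) hrV
  obtain ⟨a, b, hyab, hab, G, w, -, -, hGw⟩ := D.exists_local_model huy hV hc inter_subset_right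
    hΓV hu₀ hr hrV hΓr hrV
  obtain ⟨ε, hε, hsub⟩ := D.exists_box_subset hr hGw (isOpen_Ioo.mem_nhds hyab)
  exact ⟨ε, hε, a, b, G, w, (Ioo_subset_Icc_self.trans hab).trans inter_subset_right,
    fun p hp => ⟨(hsub hp).2, (hsub hp).1⟩⟩

theorem exists_riccati_quadrature (D : CauchyData) (huy : ∀ t ∈ D.I, D.uy t ≠ 0) :
    ∃ Ω, D.IsDomain Ω ∧ ∃ Γ u : ℝ × ℝ → ℝ, D.RiccatiIVP Ω Γ ∧ D.Quadrature Ω Γ u := by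
  have hloc := fun r (hr : r ∈ D.I) => D.exists_local_solution huy hr
  choose! ε hε a b G w hrange hsol using hloc
  -- Two local solutions are compared on the overlap of their full height intervals, not merely on
  -- the boxes: that overlap contains the height of the curve above `x`, where both take the
  -- prescribed values.
  have hagree : ∀ r ∈ D.I, ∀ r' ∈ D.I, ∀ p ∈ D.box r (ε r), p ∈ D.box r' (ε r') →
      G r p = G r' p ∧ w r p = w r' p := by
    rintro r hr r' hr' ⟨x, y⟩ hp hp'
    obtain ⟨hy, hx, hh, hG, hw, hode⟩ := hsol r hr _ hp
    obtain ⟨hy', -, hh', hG', hw', hode'⟩ := hsol r' hr' _ hp'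
    have hO : IsOpen (Ioo (a r) (b r) ∩ Ioo (a r') (b r')) := isOpen_Ioo.inter isOpen_Ioo
    have hC : (Ioo (a r) (b r) ∩ Ioo (a r') (b r')).OrdConnected :=
      ordConnected_Ioo.inter ordConnected_Ioo
    have hGG : ∀ s ∈ Ioo (a r) (b r) ∩ Ioo (a r') (b r'), G r (x, s) = G r' (x, s) := fun s hs =>
      riccati_unique hO hC (p := D.k₁) (q := D.k₂) (g₁ := fun s => G r (x, s))
        (g₂ := fun s => G r' (x, s))
        ((D.smooth_k₂ huy).continuousOn.mono (inter_subset_left.trans (hrange r hr)))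
        (fun s hs => (hode s hs.1).1) (fun s hs => (hode' s hs.2).1) ⟨hh, hh'⟩
        (hG.trans hG'.symm) hs
    exact ⟨hGG y ⟨hy, hy'⟩, quadrature_unique hO hC (g := fun s => G r (x, s))
      (u₁ := fun s => w r (x, s)) (u₂ := fun s => w r' (x, s)) (fun s hs => (hode s hs.1).2)
      (fun s hs => by simpa only [hGG s hs] using (hode' s hs.2).2) ⟨hh, hh'⟩
      (hw.trans hw'.symm) ⟨hy, hy'⟩⟩
  classical
  -- The choice of box need not be continuous in `p`, as the local solutions agree on overlaps. The
  -- value `0` is taken only off the union of the boxes.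
  let idx : ℝ × ℝ → ℝ := fun p =>
    if h : ∃ r ∈ D.I, p ∈ D.box r (ε r) then h.choose else 0
  have hidx : ∀ r ∈ D.I, ∀ p ∈ D.box r (ε r), idx p ∈ D.I ∧ p ∈ D.box (idx p) (ε (idx p)) :=
    fun r hr p hp => by
      have h : ∃ r ∈ D.I, p ∈ D.box r (ε r) := ⟨r, hr, hp⟩
      simp only [idx, dif_pos h]
      exact h.choose_spec
  have hΓeq : ∀ r ∈ D.I, ∀ p ∈ D.box r (ε r),
      G (idx p) p = G r p ∧ w (idx p) p = w r p := fun r hr p hp =>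
    hagree _ (hidx r hr p hp).1 r hr p (hidx r hr p hp).2 hp
  have hnear : ∀ r, ∀ p ∈ D.box r (ε r), ∀ᶠ s in 𝓝 p.2, (p.1, s) ∈ D.box r (ε r) :=
    fun r p hp => (isOpen_vertical (D.isOpen_box r (ε r)) p.1).mem_nhds hp
  refine ⟨_, D.isDomain_iUnion_box hε, fun p => G (idx p) p, fun p => w (idx p) p,
    ⟨fun p hp => ?_, fun t ht => ?_⟩, ⟨fun p hp => ?_, fun t ht => ?_⟩⟩
  · obtain ⟨r, hr, hpr⟩ := mem_iUnion₂.1 hp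
    obtain ⟨hy, -, -, -, -, hode⟩ := hsol r hr p hpr
    simp only [(hΓeq r hr p hpr).1]
    exact (hode p.2 hy).1.congr_of_eventuallyEq
      ((hnear r p hpr).mono fun s hs => (hΓeq r hr _ hs).1)
  · have hm := D.γ_mem_box ht (hε t ht)
    obtain ⟨-, -, -, hG, -⟩ := hsol t ht _ hm
    rw [D.paramAtFst_fst ht, height_fst ht] at hG
    exact (hΓeq t ht _ hm).1.trans hG
  · obtain ⟨r, hr, hpr⟩ := mem_iUnion₂.1 hp
    obtain ⟨hy, -, -, -, -, hode⟩ := hsol r hr p hpr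
    simp only [(hΓeq r hr p hpr).1]
    exact (hode p.2 hy).2.congr_of_eventuallyEq
      ((hnear r p hpr).mono fun s hs => (hΓeq r hr _ hs).2)
  · have hm := D.γ_mem_box ht (hε t ht)
    obtain ⟨-, -, -, -, hw, -⟩ := hsol t ht _ hm
    rw [D.paramAtFst_fst ht, height_fst ht] at hw
    exact (hΓeq t ht _ hm).2.trans hw

theorem exists_isRiccatiReduction (D : CauchyData) (hux : ∀ t ∈ D.I, D.ux t ≠ 0)
    (huy : ∀ t ∈ D.I, D.uy t ≠ 0) :
    ∃ Ω, D.IsDomain Ω ∧ ∃ Γ u v : ℝ × ℝ → ℝ, D.IsRiccatiReduction Ω Γ u v := by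
  obtain ⟨Ω', hΩ', Γ, u, h, hu⟩ := D.exists_riccati_quadrature huy
  have hcont := (contDiffOn_recovery_argument hux huy hΩ' h hu).continuousOn
  -- The first equation can be solved for a real `v` only where the expression for `exp (v/2)` is
  -- positive. This is an open condition, and it holds on `γ` because the expression equals `exp
  -- (φ₂/2)` there.
  obtain ⟨Ω, hsub, hΩ⟩ := D.exists_isDomain_subset
    (hcont.isOpen_inter_preimage hΩ'.isOpen isOpen_Ioi (t := Ioi 0)) fun t ht => by
      have hmem := hΩ'.curve_mem t ht
      refine ⟨hmem, ?_⟩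
      obtain ⟨h1, h2, h3, -⟩ := jets_of_riccati huy hΩ' h hu ht
      rw [mem_preimage, mem_Ioi, h1, h2, dx_congr hΩ'.isOpen hu.dy_eq hmem, h3, hu.initial t ht,
        ← exp_half_eq (b := D.φ₂ t) (D.uxy_ne_zero hux huy ht) (by rw [uxy]; ring)]
      exact Real.exp_pos _
  refine ⟨Ω, hΩ, Γ, u, recoveredV u, ⟨fun p hp => h.ode p (hsub hp).1, h.initial⟩,
    ⟨fun p hp => hu.ode p (hsub hp).1, hu.initial⟩, fun p hp => ?_⟩
  refine recovery_of_exp_half_eq (dx_dy_u_ne_zero hux huy hΩ' h hu (hsub hp).1) ?_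
  have hpos : 0 < -Real.exp (-(u p / 2)) * (1 + dx u p * dy u p / (2 * dx (dy u) p)) :=
    (hsub hp).2
  rw [recoveredV, mul_div_cancel_left₀ _ two_ne_zero, Real.exp_log hpos]

end CauchyData

end WaveMap

end

theorem theorem2 (D : WaveMap.CauchyData)
    (hux : ∀ t ∈ D.I, D.ux t ≠ 0) (huy : ∀ t ∈ D.I, D.uy t ≠ 0) :
    -- the reduction can be carried out on a neighbourhood of the curve
    (∃ Ω : Set (ℝ × ℝ), D.IsDomain Ω ∧
      ∃ Γ u v : ℝ × ℝ → ℝ, D.IsRiccatiReduction Ω Γ u v) ∧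
    -- wherever it is carried out, its ingredients are unique and it gives the unique solution
    (∀ Ω : Set (ℝ × ℝ), D.IsDomain Ω → ∀ Γ u v : ℝ × ℝ → ℝ, D.IsRiccatiReduction Ω Γ u v →
      (∀ Γ' : ℝ × ℝ → ℝ, D.RiccatiIVP Ω Γ' → Set.EqOn Γ' Γ Ω) ∧
      (∀ u' : ℝ × ℝ → ℝ, D.Quadrature Ω Γ u' → Set.EqOn u' u Ω) ∧
      (∀ p ∈ Ω, WaveMap.dx (WaveMap.dy u) p ≠ 0 ∧
        Real.exp (v p / 2) = -Real.exp (-(u p / 2)) *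
          (1 + WaveMap.dx u p * WaveMap.dy u p / (2 * WaveMap.dx (WaveMap.dy u) p))) ∧
      ContDiffOn ℝ ∞ Γ Ω ∧
      D.IsCauchySolution Ω u v ∧
      (∀ u' v' : ℝ × ℝ → ℝ, D.IsCauchySolution Ω u' v' →
        Set.EqOn u' u Ω ∧ Set.EqOn v' v Ω) ∧
      D.IsWaveMapCauchySolution Ω (fun p => ![(u p + v p) / 2, (u p - v p) / 2]) ∧
      (∀ U : ℝ × ℝ → Fin 2 → ℝ, D.IsWaveMapCauchySolution Ω U →
        Set.EqOn U (fun p => ![(u p + v p) / 2, (u p - v p) / 2]) Ω)) ∧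
    -- conversely, every solution of the Cauchy problem is produced by the reduction
    (∀ Ω : Set (ℝ × ℝ), D.IsDomain Ω → ∀ u v : ℝ × ℝ → ℝ, D.IsCauchySolution Ω u v →
      D.IsRiccatiReduction Ω (WaveMap.dy u) u v) := by
  refine ⟨D.exists_isRiccatiReduction hux huy, fun Ω hΩ Γ u v R => ?_,
    fun Ω hΩ u v C => C.isRiccatiReduction huy hΩ⟩
  have C := R.isCauchySolution hux huy hΩ
  exact ⟨fun Γ' h' => R.riccati.eqOn huy hΩ h',
    fun u' h' => R.quadrature.eqOn hΩ h' fun _ _ => rfl,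
    fun p hp => ⟨WaveMap.CauchyData.dx_dy_u_ne_zero hux huy hΩ R.riccati R.quadrature hp,
      R.exp_half_v hux huy hΩ hp⟩,
    (WaveMap.CauchyData.smooth_of_riccati huy hΩ R.riccati R.quadrature).1, C,
    fun u' v' C' => R.eqOn_of_isCauchySolution hux huy hΩ C',
    C.isWaveMapCauchySolution hΩ,
    fun U W => R.eqOn_of_isWaveMapCauchySolution hux huy hΩ W⟩
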